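/- Throughout, $\mathscr C$ is a bicategory. *Definitions.* A functor $p:E\to B$ is a *groupoid opfibration* if every morphism of $E$ is cocartesian for $p$ and, for all $x\in E$ and $\phi:px\to b$ in $B$, there are a morphism $\kappa:x\to z$ of $E$ and an isomorphism $pz\cong b$ whose composite with $p\kappa$ is $\phi$; a morphism $p:E\to B$ of $\mathscr C$ is a groupoid opfibration if all functors $\mathscr C(U,p)$ are. A *protocalibration* $\mathscr R$ of $\mathscr C$ is a class of morphisms of $\mathscr C$ such that: all equivalences are in $\mathscr R$, and any morphism isomorphic to one in $\mathscr R$ is in $\mathscr R$; $\mathscr R$ is closed under composition; for $f:U\to W$ in $\mathscr R$ and any $g:V\to W$ the bicategorical pullback (bipullback) $P\to V$ of $f$ along $g$ exists and is in $\mathscr R$; and every morphism in $\mathscr R$ is a groupoid opfibration. We regard $\mathscr R$ as a subbicategory containing all objects of $\mathscr C$ and all 2-morphisms between its morphisms. *Finite bicoproducts* in a bicategory $\mathscr B$ consist of a bi-initial object $0$ (each $\mathscr B(0,W)$ is equivalent to the terminal category $\mathbf 1$) and, for all $U,V$, a diagram $U\xrightarrow{i}U+V\xleftarrow{j}V$ such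 that for every $W$ the functor $\mathscr B(U+V,W)\to\mathscr B(U,W)\times\mathscr B(V,W)$ given by composition with $i$ and $j$ is an equivalence. The protocalibration $\mathscr R$ is *closed under finite bicoproducts* if all morphisms $0\to X$ out of a bi-initial object and all coprojections $i,j$ are in $\mathscr R$, and a morphism $h:U+V\to W$ is in $\mathscr R$ whenever $hi$ and $hj$ are. For $U\in\mathscr C$ let $\mathbb C_{\mathscr R}U$ be the category whose objects are the morphisms $u:S\to U$ in $\mathscr R$ and whose morphisms from $u:S\to U$ to $u':S'\to U$ are the isomorphism classes of pairs $(w:S\to S',\ u'w\cong u)$; a morphism $r:V\to U$ of $\mathscr C$ induces a functor $\mathbb C_{\mathscr R}U\to\mathbb C_{\mathscr R}V$ by bipullback along $r$. The bicategory $\mathscr C$ is *$\mathscr R$-extensive* if it has finite bicoproducts and the canonical functors $\mathbb C_{\mathscr R}0\to\mathbf 1$ and $\mathbb C_{\mathscr R}(U+V)\to\mathbb C_{\mathscr R}U\times\mathbb C_{\mathscr R}V$ (the latter given by bipullback along $i$ and $j$) are equivalences. The bicategory $\mathrm{Spn}_{\mathscr R}\mathscr C$ has the objects of $\mathscr C$;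 its morphisms $X\to Y$ are the $\mathscr R$-spans $X\xleftarrow{u}S\xrightarrow{v}Y$, that is, those spans with $u\in\mathscr R$; its 2-morphisms $(u,S,v)\Rightarrow(u',S',v')$ are isomorphism classes of triples $(f:S\to S',\ u'f\cong u,\ \sigma:v\Rightarrow v'f)$. Spans are composed by bipullback. The horizontal composite of 2-morphisms $[f,\sigma]:(u,S,v)\Rightarrow(u',S',v')$ (from $X$ to $Y$) and $[g,\tau]:(r,T,s)\Rightarrow(r',T',s')$ (from $Y$ to $Z$), where $P$ is the bipullback of $r:T\to Y$ along $v:S\to Y$, with projections $r_v:P\to S$ and $v_r:P\to T$, and similarly $P'$ is the bipullback of $r'$ along $v'$, with projections $r'_{v'}$ and $v'_{r'}$, is obtained from a lifting $\kappa:gv_r\Rightarrow k$, along the groupoid opfibration $r'$, of the composite $r'gv_r\cong rv_r\cong vr_v\xrightarrow{\sigma r_v}v'fr_v$, by taking $h:P\to P'$ with $r'_{v'}h\cong fr_v$ and $v'_{r'}h\cong k$ (compatibly with the bipullback squares); it is the class of $h$ together with the evident invertible 2-morphism on the left leg and the composite $sv_r\xrightarrow{\tau v_r}s'gv_r\xrightarrow{s'\kappa}s'k\cong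 s'v'_{r'}h$. *Proposition.* Let $\mathscr R$ be a protocalibration of $\mathscr C$. Suppose that $\mathscr C$ is $\mathscr R$-extensive and that $\mathscr R$ is closed under finite bicoproducts. Then: (i) the bicategory $\mathrm{Spn}_{\mathscr R}\mathscr C$ has finite bicoproducts; and (ii) for all objects $X,Y$ the category $\mathrm{Spn}_{\mathscr R}\mathscr C(X,Y)$ has finite coproducts, and for every $\mathscr R$-span $t=(Y\xleftarrow{u}S\xrightarrow{v}Z)$, that is, with $u\in\mathscr R$, they are preserved by the functor $\mathrm{Spn}_{\mathscr R}\mathscr C(X,Y)\to\mathrm{Spn}_{\mathscr R}\mathscr C(X,Z)$ given by composing spans $X\to Y$ with $t$ on the diagrammatic right. -/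

import Mathlib

open CategoryTheory Bicategory Limits

universe w v u

/-- A functor `p : E ⥤ B` is a groupoid opfibration: every morphism of `E` is cocartesian for `p`,
and every `φ : p x ⟶ b` is, up to an isomorphism `p z ≅ b`, the image of a morphism out of `x`. -/
structure IsGroupoidOpfibration {E : Type*} {B : Type*} [Category E] [Category B]
    (p : E ⥤ B) : Prop where
  cocartesian : ∀ {x z k : E} (κ : x ⟶ z) (g : x ⟶ k) (b : p.obj z ⟶ p.obj k),
    p.map κ ≫ b = p.map g → ∃! g' : z ⟶ k, κ ≫ g' = g ∧ p.map g' = b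
  lift : ∀ (x : E) {b : B} (φ : p.obj x ⟶ b),
    ∃ (z : E) (κ : x ⟶ z) (e : p.obj z ≅ b), p.map κ ≫ e.hom = φ

theorem IsGroupoidOpfibration.isIso {E : Type*} {B : Type*} [Category E] [Category B]
    {p : E ⥤ B} (hp : IsGroupoidOpfibration p) {x z : E} (κ : x ⟶ z) [IsIso (p.map κ)] :
    IsIso κ := by
  obtain ⟨g, ⟨h1, h2⟩, -⟩ := hp.cocartesian κ (𝟙 x) (inv (p.map κ)) (by simp)
  refine ⟨g, h1, ?_⟩
  obtain ⟨g', -, h⟩ := hp.cocartesian κ κ (𝟙 _) (by simp)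
  rw [h (g ≫ κ) ⟨by rw [← Category.assoc, h1, Category.id_comp], by simp [h2]⟩,
    h (𝟙 z) ⟨by simp, by simp⟩]

namespace RSpn

section
variable {C : Type u} [Bicategory.{w, v} C]

/-- A 1-cell `p : E ⟶ B` of a bicategory is a groupoid opfibration when each functor
`C(U, p) : C(U, E) ⥤ C(U, B)` is one. -/
def IsGroupoidOpfib {E B : C} (p : E ⟶ B) : Prop :=
  ∀ U : C, IsGroupoidOpfibration (postcomp U p)

theorem slide {U V W Z : C} {h k : U ⟶ V} (η : h ⟶ k) {a : V ⟶ W} {b : W ⟶ Z} {c : V ⟶ Z}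
    (θ : a ≫ b ⟶ c) :
    η ▷ a ▷ b ≫ (α_ k a b).hom ≫ k ◁ θ = (α_ h a b).hom ≫ h ◁ θ ≫ η ▷ c := by
  rw [whisker_exchange]; simp

theorem slide_assoc {U V W Z : C} {h k : U ⟶ V} (η : h ⟶ k) {a : V ⟶ W} {b : W ⟶ Z} {c : V ⟶ Z}
    (θ : a ≫ b ⟶ c) {d : U ⟶ Z} (ζ : k ≫ c ⟶ d) :
    η ▷ a ▷ b ≫ (α_ k a b).hom ≫ k ◁ θ ≫ ζ = (α_ h a b).hom ≫ h ◁ θ ≫ η ▷ c ≫ ζ := by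
  rw [whisker_exchange_assoc]; simp

theorem IsGroupoidOpfib.exists_lift {E B : C} {p : E ⟶ B} (hp : IsGroupoidOpfib p) {U : C}
    (x : U ⟶ E) {b : U ⟶ B} (φ : x ≫ p ⟶ b) :
    ∃ (z : U ⟶ E) (κ : x ⟶ z) (e : z ≫ p ≅ b), κ ▷ p ≫ e.hom = φ :=
  (hp U).lift x φ

theorem IsGroupoidOpfib.exists_fac {E B : C} {p : E ⟶ B} (hp : IsGroupoidOpfib p) {U : C}
    {x z k : U ⟶ E} (κ : x ⟶ z) (g : x ⟶ k) (b : z ≫ p ⟶ k ≫ p) (h : κ ▷ p ≫ b = g ▷ p) :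
    ∃ g' : z ⟶ k, κ ≫ g' = g ∧ g' ▷ p = b :=
  ((hp U).cocartesian κ g b h).exists

theorem IsGroupoidOpfib.isIso {E B : C} {p : E ⟶ B} (hp : IsGroupoidOpfib p) {U : C}
    {x z : U ⟶ E} (κ : x ⟶ z) (h : IsIso (κ ▷ p)) : IsIso κ :=
  haveI : IsIso ((postcomp U p).map κ) := h
  (hp U).isIso κ

theorem slide' {U V W Z : C} {h k : U ⟶ V} (η : h ⟶ k) {a : V ⟶ W} {b : W ⟶ Z} {c : V ⟶ Z}
    (θ : c ⟶ a ≫ b) :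
    h ◁ θ ≫ (α_ h a b).inv ≫ η ▷ a ▷ b = η ▷ c ≫ k ◁ θ ≫ (α_ k a b).inv := by
  rw [← whisker_exchange_assoc]; simp

theorem slide'_assoc {U V W Z : C} {h k : U ⟶ V} (η : h ⟶ k) {a : V ⟶ W} {b : W ⟶ Z} {c : V ⟶ Z}
    (θ : c ⟶ a ≫ b) {d : U ⟶ Z} (ζ : (k ≫ a) ≫ b ⟶ d) :
    h ◁ θ ≫ (α_ h a b).inv ≫ η ▷ a ▷ b ≫ ζ = η ▷ c ≫ k ◁ θ ≫ (α_ k a b).inv ≫ ζ := by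
  rw [← whisker_exchange_assoc]; simp

/-- A square over the cospan `f`, `g` that commutes up to a given invertible 2-cell. -/
structure BipullbackCone {U V W : C} (f : U ⟶ W) (g : V ⟶ W) where
  pt : C
  fst : pt ⟶ U
  snd : pt ⟶ V
  iso : fst ≫ f ≅ snd ≫ g

namespace BipullbackCone
variable {U V W : C} {f : U ⟶ W} {g : V ⟶ W}

theorem comparison_aux (c : BipullbackCone f g) {T : C} {h k : T ⟶ c.pt} (η : h ⟶ k) :
    (η ▷ c.fst) ▷ f ≫ (α_ k c.fst f ≪≫ whiskerLeftIso k c.iso ≪≫ (α_ k c.snd g).symm).hom =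
      (α_ h c.fst f ≪≫ whiskerLeftIso h c.iso ≪≫ (α_ h c.snd g).symm).hom ≫ (η ▷ c.snd) ▷ g := by
  simp [slide_assoc]

/-- The functor from 1-cells `T ⟶ c.pt` to the category of squares over `f`, `g` with vertex `T`
(the pseudo-pullback of the hom-categories) given by composing with the square `c`. -/
def comparison (c : BipullbackCone f g) (T : C) :
    (T ⟶ c.pt) ⥤ CategoricalPullback (postcomp T f) (postcomp T g) where
  obj h :=
    { fst := h ≫ c.fst
      snd := h ≫ c.snd
      iso := α_ h c.fst f ≪≫ whiskerLeftIso h c.iso ≪≫ (α_ h c.snd g).symm }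
  map η := { fst := η ▷ c.fst, snd := η ▷ c.snd, w := comparison_aux c η }

/-- The square is a bipullback: for every `T` the comparison functor from `C(T, c.pt)` to the
pseudo-pullback of `C(T, f)` and `C(T, g)` is an equivalence of categories. -/
def IsBipullback (c : BipullbackCone f g) : Prop :=
  ∀ T : C, (c.comparison T).IsEquivalence

theorem IsBipullback.exists_lift {c : BipullbackCone f g} (hc : c.IsBipullback) {T : C}
    (y : T ⟶ U) (x : T ⟶ V) (e : y ≫ f ≅ x ≫ g) :
    ∃ (h : T ⟶ c.pt) (i : h ≫ c.fst ≅ y) (j : h ≫ c.snd ≅ x),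
      i.hom ▷ f ≫ e.hom =
        (α_ h c.fst f).hom ≫ h ◁ c.iso.hom ≫ (α_ h c.snd g).inv ≫ j.hom ▷ g := by
  have := hc T
  let o : CategoricalPullback (postcomp T f) (postcomp T g) := ⟨y, x, e⟩
  let i : (c.comparison T).obj ((c.comparison T).objPreimage o) ≅ o :=
    (c.comparison T).objObjPreimageIso o
  let h : T ⟶ c.pt := (c.comparison T).objPreimage o
  let i1 : h ≫ c.fst ≅ y := (CategoricalPullback.π₁ _ _).mapIso i
  let i2 : h ≫ c.snd ≅ x := (CategoricalPullback.π₂ _ _).mapIso i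
  have w : i1.hom ▷ f ≫ e.hom = ((α_ h c.fst f).hom ≫ h ◁ c.iso.hom ≫
    (α_ h c.snd g).inv) ≫ i2.hom ▷ g := i.hom.w
  exact ⟨h, i1, i2, by simpa only [Category.assoc] using w⟩

/-- The invertible 2-cell obtained by composing `h` with the square `c`. -/
abbrev fill (c : BipullbackCone f g) {T : C} (h : T ⟶ c.pt) :
    (h ≫ c.fst) ≫ f ≅ (h ≫ c.snd) ≫ g :=
  α_ h c.fst f ≪≫ whiskerLeftIso h c.iso ≪≫ (α_ h c.snd g).symm

theorem fill_naturality (c : BipullbackCone f g) {T : C} {h k : T ⟶ c.pt} (η : h ⟶ k) :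
    η ▷ c.fst ▷ f ≫ (c.fill k).hom = (c.fill h).hom ≫ η ▷ c.snd ▷ g :=
  comparison_aux c η

theorem IsBipullback.exists_hom {c : BipullbackCone f g} (hc : c.IsBipullback) {T : C}
    {h k : T ⟶ c.pt} (i : h ≫ c.fst ⟶ k ≫ c.fst) (j : h ≫ c.snd ⟶ k ≫ c.snd)
    (w : i ▷ f ≫ (c.fill k).hom = (c.fill h).hom ≫ j ▷ g) :
    ∃ γ : h ⟶ k, γ ▷ c.fst = i ∧ γ ▷ c.snd = j ∧ (IsIso i → IsIso j → IsIso γ) := by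
  have := hc T
  let γ : (c.comparison T).obj h ⟶ (c.comparison T).obj k := ⟨i, j, w⟩
  refine ⟨(c.comparison T).preimage γ, ?_, ?_, fun hi hj => ?_⟩
  · exact congrArg CategoricalPullback.Hom.fst ((c.comparison T).map_preimage γ)
  · exact congrArg CategoricalPullback.Hom.snd ((c.comparison T).map_preimage γ)
  · have : IsIso γ := (CategoricalPullback.isIso_iff _ _ γ).2 ⟨hi, hj⟩
    have : IsIso ((c.comparison T).map ((c.comparison T).preimage γ)) := by
      rw [(c.comparison T).map_preimage]; exact this
    exact isIso_of_reflects_iso _ (c.comparison T)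

/-- `(h, a, b)` factors the lax square `θ` through the square `c`: `h ≫ c.snd ≅ x` by `a`, and
`θ` is recovered from `c.iso` by pasting with `b : y ⟶ h ≫ c.fst` and `a`. -/
def IsLift (c : BipullbackCone f g) {T : C} {x : T ⟶ V} {y : T ⟶ U} (θ : y ≫ f ⟶ x ≫ g)
    (h : T ⟶ c.pt) (a : h ≫ c.snd ≅ x) (b : y ⟶ h ≫ c.fst) : Prop :=
  b ▷ f ≫ (c.fill h).hom ≫ a.hom ▷ g = θ

theorem IsLift.comp_fill {c : BipullbackCone f g} {T : C} {x : T ⟶ V} {y : T ⟶ U}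
    {θ : y ≫ f ⟶ x ≫ g} {h : T ⟶ c.pt} {a : h ≫ c.snd ≅ x} {b : y ⟶ h ≫ c.fst}
    (H : c.IsLift θ h a b) : b ▷ f ≫ (c.fill h).hom = θ ≫ a.inv ▷ g := by
  unfold IsLift at H
  rw [← H]
  simp

theorem IsLift.pre {c : BipullbackCone f g} {T T' : C} (j : T' ⟶ T) {x : T ⟶ V} {y : T ⟶ U}
    {θ : y ≫ f ⟶ x ≫ g} {h : T ⟶ c.pt} {a : h ≫ c.snd ≅ x} {b : y ⟶ h ≫ c.fst}
    (H : c.IsLift θ h a b) :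
    c.IsLift (x := j ≫ x) (y := j ≫ y) ((α_ _ _ _).hom ≫ j ◁ θ ≫ (α_ _ _ _).inv) (j ≫ h)
      (α_ _ _ _ ≪≫ whiskerLeftIso j a) (j ◁ b ≫ (α_ _ _ _).inv) := by
  unfold IsLift at H ⊢
  rw [← H]
  simp

theorem IsBipullback.exists_isLift {c : BipullbackCone f g} (hc : c.IsBipullback)
    (hf : IsGroupoidOpfib f) {T : C} {x : T ⟶ V} {y : T ⟶ U} (θ : y ≫ f ⟶ x ≫ g) :
    ∃ (h : T ⟶ c.pt) (a : h ≫ c.snd ≅ x) (b : y ⟶ h ≫ c.fst), c.IsLift θ h a b := by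
  obtain ⟨z, κ, e, he⟩ := hf.exists_lift y θ
  obtain ⟨h, i1, i2, hi⟩ := hc.exists_lift z x e
  refine ⟨h, i2, κ ≫ i1.inv, ?_⟩
  simp [IsLift, ← hi, he]

theorem IsBipullback.exists_hom_of_isLift {c : BipullbackCone f g} (hc : c.IsBipullback)
    (hf : IsGroupoidOpfib f) {T : C} {y : T ⟶ U} {h k : T ⟶ c.pt} (b : y ⟶ h ≫ c.fst)
    (ξ : h ≫ c.snd ⟶ k ≫ c.snd) (η : y ⟶ k ≫ c.fst)
    (w : b ▷ f ≫ (c.fill h).hom ≫ ξ ▷ g = η ▷ f ≫ (c.fill k).hom) :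
    ∃ γ : h ⟶ k, γ ▷ c.snd = ξ ∧ b ≫ γ ▷ c.fst = η ∧ (IsIso ξ → IsIso γ) := by
  obtain ⟨δ, hδ, hδ'⟩ := hf.exists_fac b η ((c.fill h).hom ≫ ξ ▷ g ≫ (c.fill k).inv) (by
    simp only [← Category.assoc, Iso.comp_inv_eq]
    simpa only [Category.assoc] using w)
  obtain ⟨γ, h1, h2, h3⟩ := hc.exists_hom δ ξ (by rw [hδ']; simp)
  refine ⟨γ, h2, by rw [h1, hδ], fun hξ => h3 (hf.isIso δ ?_) hξ⟩
  rw [hδ']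
  infer_instance

end BipullbackCone
end

/-- A protocalibration of the bicategory `C`: a class of 1-cells that contains the equivalences, is
closed under isomorphism and composition, is stable under (existing) bipullback along arbitrary
1-cells, and consists of groupoid opfibrations. -/
structure Protocalibration (C : Type u) [Bicategory.{w, v} C] where
  mem : MorphismProperty C
  mem_equivalence : ∀ {X Y : C} (e : X ≌ Y), mem e.hom
  mem_of_iso : ∀ {X Y : C} {f g : X ⟶ Y}, (f ≅ g) → mem f → mem g
  mem_comp : ∀ {X Y Z : C} {f : X ⟶ Y} {g : Y ⟶ Z}, mem f → mem g → mem (f ≫ g)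
  exists_bipullback : ∀ {U V W : C} (f : U ⟶ W) (g : V ⟶ W), mem f →
    ∃ c : BipullbackCone f g, c.IsBipullback ∧ mem c.snd
  opfib : ∀ {X Y : C} {f : X ⟶ Y}, mem f → IsGroupoidOpfib f

namespace Protocalibration
variable {C : Type u} [Bicategory.{w, v} C] (R : Protocalibration C)

theorem isIso_of_isLift {U V W : C} {f : U ⟶ W} {g : V ⟶ W} (c : BipullbackCone f g)
    (hf : IsGroupoidOpfib f) {T : C} {x : T ⟶ V} {y : T ⟶ U} {θ : y ≫ f ⟶ x ≫ g}
    {h : T ⟶ c.pt} {a : h ≫ c.snd ≅ x} {b : y ⟶ h ≫ c.fst} (H : c.IsLift θ h a b) [IsIso θ] :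
    IsIso b := by
  refine hf.isIso b ?_
  have : b ▷ f = θ ≫ a.inv ▷ g ≫ (c.fill h).inv := by rw [← H]; simp
  rw [this]
  infer_instance

theorem mem_id (X : C) : R.mem (𝟙 X) := R.mem_equivalence (Equivalence.id X)

/-- A chosen bipullback of `f` in `R` along `g`. -/
noncomputable def pullback {U V W : C} (f : U ⟶ W) (hf : R.mem f) (g : V ⟶ W) :
    BipullbackCone f g := (R.exists_bipullback f g hf).choose

theorem pullback_isBipullback {U V W : C} (f : U ⟶ W) (hf : R.mem f) (g : V ⟶ W) :
    (R.pullback f hf g).IsBipullback := (R.exists_bipullback f g hf).choose_spec.1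

theorem pullback_snd_mem {U V W : C} (f : U ⟶ W) (hf : R.mem f) (g : V ⟶ W) :
    R.mem (R.pullback f hf g).snd := (R.exists_bipullback f g hf).choose_spec.2

end Protocalibration

/-- A span `X ⟵ apex ⟶ Y`. -/
structure SpanDiagram {C : Type u} [Bicategory.{w, v} C] (X Y : C) where
  apex : C
  left : apex ⟶ X
  right : apex ⟶ Y

namespace SpanDiagram
variable {C : Type u} [Bicategory.{w, v} C] {X Y Z W : C}

/-- A representative of a 2-cell of spans: `f` between the apices, an invertible 2-cell
`φ : f ≫ t.left ≅ s.left`, and a 2-cell `σ : s.right ⟶ f ≫ t.right`. -/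
structure PreHom (s t : SpanDiagram X Y) where
  f : s.apex ⟶ t.apex
  φ : f ≫ t.left ≅ s.left
  σ : s.right ⟶ f ≫ t.right

namespace PreHom

abbrev id (s : SpanDiagram X Y) : PreHom s s := ⟨𝟙 _, λ_ _, (λ_ _).inv⟩

abbrev comp {s t r : SpanDiagram X Y} (m : PreHom s t) (n : PreHom t r) : PreHom s r where
  f := m.f ≫ n.f
  φ := α_ _ _ _ ≪≫ whiskerLeftIso m.f n.φ ≪≫ m.φ
  σ := m.σ ≫ m.f ◁ n.σ ≫ (α_ _ _ _).inv

/-- Two representatives are isomorphic when their middle 1-cells are, compatibly with `φ`, `σ`. -/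
def Rel {s t : SpanDiagram X Y} (m n : PreHom s t) : Prop :=
  ∃ γ : m.f ≅ n.f, γ.hom ▷ t.left ≫ n.φ.hom = m.φ.hom ∧ m.σ ≫ γ.hom ▷ t.right = n.σ

def setoid (s t : SpanDiagram X Y) : Setoid (PreHom s t) where
  r := Rel
  iseqv :=
    { refl := fun m => ⟨Iso.refl _, by simp, by simp⟩
      symm := by
        rintro m n ⟨γ, h1, h2⟩
        exact ⟨γ.symm, by simp [← h1], by simp [← h2]⟩
      trans := by
        rintro m n k ⟨γ, h1, h2⟩ ⟨δ, h3, h4⟩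
        exact ⟨γ ≪≫ δ, by simp [h1, h3], by simp [← h2, ← h4]⟩ }

theorem comp_rel {s t r : SpanDiagram X Y} {m m' : PreHom s t} {n n' : PreHom t r}
    (hm : Rel m m') (hn : Rel n n') : Rel (m.comp n) (m'.comp n') := by
  obtain ⟨γ, h1, h2⟩ := hm
  obtain ⟨δ, h3, h4⟩ := hn
  refine ⟨whiskerRightIso γ n.f ≪≫ whiskerLeftIso m'.f δ, ?_, ?_⟩
  · have := slide_assoc γ.hom (δ.hom ▷ r.left ≫ n'.φ.hom) m'.φ.hom
    simp at this
    simp [← h1, ← h3, this]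
  · simp [← h2, ← h4, ← whisker_exchange_assoc]

end PreHom

/-- 2-cells of spans: isomorphism classes of representatives. -/
def Hom (s t : SpanDiagram X Y) := _root_.Quotient (PreHom.setoid s t)

instance : Category (SpanDiagram X Y) where
  Hom := Hom
  id s := _root_.Quotient.mk _ (PreHom.id s)
  comp := _root_.Quotient.map₂ PreHom.comp (fun _ _ h _ _ h' => PreHom.comp_rel h h')
  id_comp := by
    rintro s t ⟨m⟩
    exact _root_.Quotient.sound ⟨λ_ _, by simp, by simp⟩
  comp_id := by
    rintro s t ⟨m⟩
    exact _root_.Quotient.sound ⟨ρ_ _, by simp, by simp⟩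
  assoc := by
    rintro s t r q ⟨m⟩ ⟨n⟩ ⟨k⟩
    exact _root_.Quotient.sound ⟨α_ _ _ _, by simp, by simp⟩


end SpanDiagram

/-- An `R`-span from `X` to `Y`: a span whose left leg is in `R`. -/
structure Protocalibration.RSpan {C : Type u} [Bicategory.{w, v} C] (R : Protocalibration C)
    (X Y : C) extends SpanDiagram X Y where
  left_mem : R.mem left

namespace RSpan
variable {C : Type u} [Bicategory.{w, v} C] {R : Protocalibration C} {X Y Z W : C}

open SpanDiagram

instance : CoeOut (R.RSpan X Y) (SpanDiagram X Y) := ⟨Protocalibration.RSpan.toSpanDiagram⟩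

/-- The identity `R`-span. -/
abbrev id (R : Protocalibration C) (X : C) : R.RSpan X X := ⟨⟨X, 𝟙 X, 𝟙 X⟩, R.mem_id X⟩

/-- The bipullback used to compose two spans. -/
noncomputable abbrev pb (s : R.RSpan X Y) (t : R.RSpan Y Z) : BipullbackCone t.left s.right :=
  R.pullback t.left t.left_mem s.right

theorem pb_isBipullback (s : R.RSpan X Y) (t : R.RSpan Y Z) : (pb s t).IsBipullback :=
  R.pullback_isBipullback t.left t.left_mem s.right

/-- Composition of `R`-spans by bipullback. -/
noncomputable abbrev comp (s : R.RSpan X Y) (t : R.RSpan Y Z) : R.RSpan X Z where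
  apex := (pb s t).pt
  left := (pb s t).snd ≫ s.left
  right := (pb s t).fst ≫ t.right
  left_mem := R.mem_comp (R.pullback_snd_mem _ _ _) s.left_mem

/-- Data `x`, `y` on the apices with a 2-cell `θ : y ≫ t.left ⟶ x ≫ s.right` and with 2-cells
on the outer legs; each such datum induces exactly one 2-cell from `q` to `comp s t`. -/
structure LaxCone (q : SpanDiagram X Z) (s : R.RSpan X Y) (t : R.RSpan Y Z) where
  x : q.apex ⟶ s.apex
  y : q.apex ⟶ t.apex
  θ : y ≫ t.left ⟶ x ≫ s.right
  φ : x ≫ s.left ≅ q.left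
  σ : q.right ⟶ y ≫ t.right

section
variable {q q' : SpanDiagram X Z} {s s' s'' : R.RSpan X Y} {t t' t'' : R.RSpan Y Z}

/-- The 2-cells `ξ`, `η` are compatible with all the structure of two such data. -/
structure LaxCone.IsHom (c c' : LaxCone q s t) (ξ : c.x ≅ c'.x) (η : c'.y ⟶ c.y) : Prop where
  hθ : η ▷ t.left ≫ c.θ ≫ ξ.hom ▷ s.right = c'.θ
  hφ : ξ.hom ▷ s.left ≫ c'.φ.hom = c.φ.hom
  hσ : c'.σ ≫ η ▷ t.right = c.σ

def LaxCone.Le (c c' : LaxCone q s t) : Prop := ∃ ξ η, c.IsHom c' ξ η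

theorem LaxCone.Le.trans {c c' c'' : LaxCone q s t} (h : c.Le c') (h' : c'.Le c'') : c.Le c'' := by
  obtain ⟨ξ, η, h1, h2, h3⟩ := h
  obtain ⟨ξ', η', h1', h2', h3'⟩ := h'
  exact ⟨ξ ≪≫ ξ', η' ≫ η, by simp [← h1, ← h1'], by simp [← h2, ← h2'], by simp [← h3, ← h3']⟩

/-- The datum obtained by composing `k` with the projections of the bipullback. -/
noncomputable abbrev coneOf (k : PreHom q (comp s t)) : LaxCone q s t where
  x := k.f ≫ (pb s t).snd
  y := k.f ≫ (pb s t).fst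
  θ := ((pb s t).fill k.f).hom
  φ := α_ _ _ _ ≪≫ k.φ
  σ := k.σ ≫ (α_ _ _ _).inv

/-- The datum given by the bipullback itself. -/
noncomputable abbrev unitCone (s : R.RSpan X Y) (t : R.RSpan Y Z) :
    LaxCone (comp s t).toSpanDiagram s t where
  x := (pb s t).snd
  y := (pb s t).fst
  θ := (pb s t).iso.hom
  φ := Iso.refl _
  σ := 𝟙 _

/-- Precomposition of a datum with a 2-cell of spans. -/
abbrev LaxCone.pre (j : PreHom q' q) (c : LaxCone q s t) : LaxCone q' s t where
  x := j.f ≫ c.x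
  y := j.f ≫ c.y
  θ := (α_ _ _ _).hom ≫ j.f ◁ c.θ ≫ (α_ _ _ _).inv
  φ := α_ _ _ _ ≪≫ whiskerLeftIso j.f c.φ ≪≫ j.φ
  σ := j.σ ≫ j.f ◁ c.σ ≫ (α_ _ _ _).inv

/-- Postcomposition of a datum with 2-cells of spans. -/
abbrev LaxCone.post (c : LaxCone q s t) (m : PreHom s.toSpanDiagram s'.toSpanDiagram)
    (n : PreHom t.toSpanDiagram t'.toSpanDiagram) : LaxCone q s' t' where
  x := c.x ≫ m.f
  y := c.y ≫ n.f
  θ := (α_ _ _ _).hom ≫ c.y ◁ n.φ.hom ≫ c.θ ≫ c.x ◁ m.σ ≫ (α_ _ _ _).inv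
  φ := α_ _ _ _ ≪≫ whiskerLeftIso c.x m.φ ≪≫ c.φ
  σ := c.σ ≫ c.y ◁ n.σ ≫ (α_ _ _ _).inv

theorem LaxCone.Le.pre (j : PreHom q' q) {c c' : LaxCone q s t} (h : c.Le c') :
    (c.pre j).Le (c'.pre j) := by
  obtain ⟨ξ, η, h1, h2, h3⟩ := h
  exact ⟨whiskerLeftIso j.f ξ, j.f ◁ η, by simp [← h1], by simp [← h2], by simp [← h3]⟩

theorem LaxCone.Le.post {c c' : LaxCone q s t} (h : c.Le c')
    (m : PreHom s.toSpanDiagram s'.toSpanDiagram)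
    (n : PreHom t.toSpanDiagram t'.toSpanDiagram) : (c.post m n).Le (c'.post m n) := by
  obtain ⟨ξ, η, h1, h2, h3⟩ := h
  refine ⟨whiskerRightIso ξ m.f, η ▷ n.f, ?_, ?_, ?_⟩
  · simp [← h1, slide_assoc, slide']
  · simp [← h2, slide_assoc]
  · simp [← h3, slide']

/-- The 2-cell `κ` is induced by the datum `c`: it has a representative `k` whose composites with
the projections are related to `c` by an invertible 2-cell `ξ` (on the side of `s`) and a 2-cell
`η` (on the side of `t`), which paste with the bipullback square to `c.θ`, `c.φ`, `c.σ`. -/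
def Lifts (κ : q ⟶ (comp s t).toSpanDiagram) (c : LaxCone q s t) : Prop :=
  ∃ k : PreHom q (comp s t).toSpanDiagram, (coneOf k).Le c ∧ _root_.Quotient.mk _ k = κ

theorem Lifts.le {κ : q ⟶ (comp s t).toSpanDiagram} {c c' : LaxCone q s t}
    (h : Lifts κ c) (h' : c.Le c') : Lifts κ c' := by
  obtain ⟨k, hk, rfl⟩ := h
  exact ⟨k, hk.trans h', rfl⟩

theorem coneOf_le_of_rel {k k' : PreHom q (comp s t).toSpanDiagram} (h : PreHom.Rel k k') :
    (coneOf k').Le (coneOf k) := by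
  obtain ⟨γ, h1, h2⟩ := h
  refine ⟨whiskerRightIso γ.symm _, γ.hom ▷ _, ?_, ?_, ?_⟩
  · simp [slide_assoc]
  · simp [← h1]
  · simp [← h2]

theorem Lifts.rep {k : PreHom q (comp s t).toSpanDiagram} {c : LaxCone q s t}
    (h : Lifts (_root_.Quotient.mk _ k) c) : (coneOf k).Le c := by
  obtain ⟨k', hk, e⟩ := h
  exact (coneOf_le_of_rel (_root_.Quotient.exact e)).trans hk

theorem exists_lift (c : LaxCone q s t) : ∃ κ : q ⟶ (comp s t).toSpanDiagram, Lifts κ c := by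
  obtain ⟨h, a, b, H⟩ := (pb_isBipullback s t).exists_isLift (R.opfib t.left_mem) c.θ
  refine ⟨_, ⟨h, (α_ _ _ _).symm ≪≫ whiskerRightIso a _ ≪≫ c.φ,
    c.σ ≫ b ▷ t.right ≫ (α_ _ _ _).hom⟩, ⟨a, b, H, ?_, ?_⟩, rfl⟩
  · simp
  · simp

theorem lift_unique {c : LaxCone q s t} {κ κ' : q ⟶ (comp s t).toSpanDiagram}
    (h : Lifts κ c) (h' : Lifts κ' c) : κ = κ' := by
  obtain ⟨k, ⟨a, b, hθ, hφ, hσ⟩, rfl⟩ := h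
  obtain ⟨k', ⟨a', b', hθ', hφ', hσ'⟩, rfl⟩ := h'
  obtain ⟨γ, h1, h2, h3⟩ := (pb_isBipullback s t).exists_hom_of_isLift (R.opfib t.left_mem) b
    (a.hom ≫ a'.inv) b' (by
      have h1 : b ▷ t.left ≫ ((pb s t).fill k.f).hom = c.θ ≫ a.inv ▷ s.right := by simp [← hθ]
      have h2 : b' ▷ t.left ≫ ((pb s t).fill k'.f).hom = c.θ ≫ a'.inv ▷ s.right := by simp [← hθ']
      rw [reassoc_of% h1, h2]; simp)
  have := h3 inferInstance
  refine _root_.Quotient.sound ⟨asIso γ, ?_, ?_⟩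
  · have g1 : k.φ.hom = (α_ _ _ _).inv ≫ a.hom ▷ s.left ≫ c.φ.hom := by simp [hφ]
    have g2 : k'.φ.hom = (α_ _ _ _).inv ≫ a'.hom ▷ s.left ≫ c.φ.hom := by simp [hφ']
    rw [g1, g2, asIso_hom, whiskerRight_comp, h1]
    simp
  · have g1 : k.σ = c.σ ≫ b ▷ t.right ≫ (α_ _ _ _).hom := by simp [reassoc_of% hσ]
    have g2 : k'.σ = c.σ ≫ b' ▷ t.right ≫ (α_ _ _ _).hom := by simp [reassoc_of% hσ']
    rw [g1, g2, asIso_hom, whiskerRight_comp, ← h2]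
    simp

theorem lifts_coneOf (k : PreHom q (comp s t).toSpanDiagram) :
    Lifts (_root_.Quotient.mk _ k) (coneOf k) :=
  ⟨k, ⟨Iso.refl _, 𝟙 _, by simp, by simp, by simp⟩, rfl⟩

theorem lifts_id (s : R.RSpan X Y) (t : R.RSpan Y Z) :
    Lifts (𝟙 (comp s t).toSpanDiagram) (unitCone s t) :=
  ⟨PreHom.id _, ⟨λ_ _, (λ_ _).inv, by simp, by simp, by simp⟩, rfl⟩

theorem Lifts.pre {κ : q ⟶ (comp s t).toSpanDiagram} {c : LaxCone q s t}
    (h : Lifts κ c) (j : PreHom q' q) :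
    Lifts ((_root_.Quotient.mk _ j : q' ⟶ q) ≫ κ) (c.pre j) := by
  obtain ⟨k, hk, rfl⟩ := h
  refine ⟨j.comp k, LaxCone.Le.trans ?_ (hk.pre j), rfl⟩
  exact ⟨α_ _ _ _, (α_ _ _ _).inv, by simp, by simp, by simp⟩

theorem pre_unitCone_le (k : PreHom q (comp s t).toSpanDiagram) {c : LaxCone q s t}
    (h : (coneOf k).Le c) : ((unitCone s t).pre k).Le c :=
  LaxCone.Le.trans (c' := coneOf k) ⟨Iso.refl _, 𝟙 _, by simp, by simp, by simp⟩ h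

theorem pre_post_le (j : PreHom q' q) (c : LaxCone q s t)
    (m : PreHom s.toSpanDiagram s'.toSpanDiagram)
    (n : PreHom t.toSpanDiagram t'.toSpanDiagram) :
    ((c.post m n).pre j).Le ((c.pre j).post m n) :=
  ⟨(α_ _ _ _).symm, (α_ _ _ _).hom, by simp, by simp, by simp⟩

theorem post_le_of_rel (c : LaxCone q s t) {m m' : PreHom s.toSpanDiagram s'.toSpanDiagram}
    {n n' : PreHom t.toSpanDiagram t'.toSpanDiagram} (hm : PreHom.Rel m m')
    (hn : PreHom.Rel n n') : (c.post m n).Le (c.post m' n') := by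
  obtain ⟨γ, h1, h2⟩ := hm
  obtain ⟨δ, h3, h4⟩ := hn
  exact ⟨whiskerLeftIso c.x γ, c.y ◁ δ.inv, by simp [← h2, ← h3], by simp [← h1], by simp [← h4]⟩

/-- The unique 2-cell induced by a datum. -/
noncomputable def lift (c : LaxCone q s t) : q ⟶ (comp s t).toSpanDiagram := (exists_lift c).choose

theorem lifts_lift (c : LaxCone q s t) : Lifts (lift c) c := (exists_lift c).choose_spec

/-- Horizontal composition of 2-cells of `R`-spans `[f, σ]`, `[g, τ]`: the class of `[h, ρ]`, where
`h` lies over `f` up to an invertible 2-cell and under `g` through a 2-cell that lifts the pasting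
of the bipullback with `σ` along the left leg of the target. -/
noncomputable def hcomp (m : s.toSpanDiagram ⟶ s'.toSpanDiagram)
    (n : t.toSpanDiagram ⟶ t'.toSpanDiagram) :
    (comp s t).toSpanDiagram ⟶ (comp s' t').toSpanDiagram :=
  _root_.Quotient.lift₂ (fun m n => lift ((unitCone s t).post m n))
    (fun _ _ _ _ hm hn => lift_unique ((lifts_lift _).le (post_le_of_rel _ hm hn)) (lifts_lift _))
    m n

theorem lifts_hcomp (m : PreHom s.toSpanDiagram s'.toSpanDiagram)
    (n : PreHom t.toSpanDiagram t'.toSpanDiagram) :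
    Lifts (hcomp (s := s) (s' := s') (t := t) (t' := t')
      (_root_.Quotient.mk _ m) (_root_.Quotient.mk _ n)) ((unitCone s t).post m n) :=
  lifts_lift _

theorem Lifts.post {κ : q ⟶ (comp s t).toSpanDiagram} {c : LaxCone q s t} (h : Lifts κ c)
    (m : PreHom s.toSpanDiagram s'.toSpanDiagram)
    (n : PreHom t.toSpanDiagram t'.toSpanDiagram) :
    Lifts (κ ≫ hcomp (s := s) (s' := s') (t := t) (t' := t')
      (_root_.Quotient.mk _ m) (_root_.Quotient.mk _ n)) (c.post m n) := by
  obtain ⟨k, hk, rfl⟩ := h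
  exact ((lifts_hcomp m n).pre k).le
    ((pre_post_le k _ m n).trans ((pre_unitCone_le k hk).post m n))

theorem hcomp_id (s : R.RSpan X Y) (t : R.RSpan Y Z) :
    hcomp (𝟙 s.toSpanDiagram) (𝟙 t.toSpanDiagram) = 𝟙 (comp s t).toSpanDiagram :=
  lift_unique ((lifts_hcomp (PreHom.id _) (PreHom.id _)).le
    ⟨ρ_ _, (ρ_ _).inv, by simp, by simp, by simp⟩) (lifts_id s t)

theorem hcomp_comp (m : s.toSpanDiagram ⟶ s'.toSpanDiagram)
    (m' : s'.toSpanDiagram ⟶ s''.toSpanDiagram) (n : t.toSpanDiagram ⟶ t'.toSpanDiagram)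
    (n' : t'.toSpanDiagram ⟶ t''.toSpanDiagram) :
    hcomp (m ≫ m') (n ≫ n') = hcomp m n ≫ hcomp m' n' := by
  obtain ⟨m⟩ := m
  obtain ⟨m'⟩ := m'
  obtain ⟨n⟩ := n
  obtain ⟨n'⟩ := n'
  refine lift_unique ((lifts_hcomp (m.comp m') (n.comp n')).le ?_) ((lifts_hcomp m n).post m' n')
  exact ⟨(α_ _ _ _).symm, (α_ _ _ _).hom, by simp, by simp, by simp⟩

end


/-- The analogous data for a composite of three spans. -/
structure TriCone (q : SpanDiagram X W) (s : R.RSpan X Y) (t : R.RSpan Y Z) (p : R.RSpan Z W) where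
  x : q.apex ⟶ s.apex
  y : q.apex ⟶ t.apex
  z : q.apex ⟶ p.apex
  θ : y ≫ t.left ⟶ x ≫ s.right
  ζ : z ≫ p.left ⟶ y ≫ t.right
  φ : x ≫ s.left ≅ q.left
  σ : q.right ⟶ z ≫ p.right

section
variable {q q' : SpanDiagram X W} {s s' : R.RSpan X Y} {t t' : R.RSpan Y Z} {p p' : R.RSpan Z W}

structure TriCone.IsHom (c c' : TriCone q s t p) (ξ : c.x ≅ c'.x) (η : c'.y ⟶ c.y)
    (ω : c'.z ⟶ c.z) : Prop where
  hθ : η ▷ t.left ≫ c.θ ≫ ξ.hom ▷ s.right = c'.θ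
  hζ : ω ▷ p.left ≫ c.ζ = c'.ζ ≫ η ▷ t.right
  hφ : ξ.hom ▷ s.left ≫ c'.φ.hom = c.φ.hom
  hσ : c'.σ ≫ ω ▷ p.right = c.σ

def TriCone.Le (c c' : TriCone q s t p) : Prop := ∃ ξ η ω, c.IsHom c' ξ η ω

noncomputable abbrev TriCone.coneR (c : TriCone q s t p) (y : q.apex ⟶ (comp t p).apex)
    (a : y ≫ (pb t p).snd ≅ c.y) (b : c.z ⟶ y ≫ (pb t p).fst) : LaxCone q s (comp t p) where
  x := c.x
  y := y
  θ := (α_ _ _ _).inv ≫ a.hom ▷ t.left ≫ c.θ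
  φ := c.φ
  σ := c.σ ≫ b ▷ p.right ≫ (α_ _ _ _).hom

noncomputable abbrev TriCone.coneL (c : TriCone q s t p) (x : q.apex ⟶ (comp s t).apex)
    (a : x ≫ (pb s t).snd ≅ c.x) (b : c.y ⟶ x ≫ (pb s t).fst) : LaxCone q (comp s t) p where
  x := x
  y := c.z
  θ := c.ζ ≫ b ▷ t.right ≫ (α_ _ _ _).hom
  φ := (α_ _ _ _).symm ≪≫ whiskerRightIso a s.left ≪≫ c.φ
  σ := c.σ

def LiftsR (κ : q ⟶ (comp s (comp t p)).toSpanDiagram) (c : TriCone q s t p) : Prop :=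
  ∃ y a b, (pb t p).IsLift c.ζ y a b ∧ Lifts κ (c.coneR y a b)

def LiftsL (κ : q ⟶ (comp (comp s t) p).toSpanDiagram) (c : TriCone q s t p) : Prop :=
  ∃ x a b, (pb s t).IsLift c.θ x a b ∧ Lifts κ (c.coneL x a b)

theorem exists_liftR (c : TriCone q s t p) :
    ∃ κ : q ⟶ (comp s (comp t p)).toSpanDiagram, LiftsR κ c := by
  obtain ⟨y, a, b, h⟩ := (pb_isBipullback t p).exists_isLift (R.opfib p.left_mem) c.ζ
  obtain ⟨κ, hκ⟩ := exists_lift (c.coneR y a b)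
  exact ⟨κ, y, a, b, h, hκ⟩

theorem exists_liftL (c : TriCone q s t p) :
    ∃ κ : q ⟶ (comp (comp s t) p).toSpanDiagram, LiftsL κ c := by
  obtain ⟨x, a, b, h⟩ := (pb_isBipullback s t).exists_isLift (R.opfib t.left_mem) c.θ
  obtain ⟨κ, hκ⟩ := exists_lift (c.coneL x a b)
  exact ⟨κ, x, a, b, h, hκ⟩

theorem LiftsR.le' {κ : q ⟶ (comp s (comp t p)).toSpanDiagram} {c c' : TriCone q s t p}
    (h : LiftsR κ c) (h' : c.Le c') (y' a' b') (H' : (pb t p).IsLift c'.ζ y' a' b') :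
    Lifts κ (c'.coneR y' a' b') := by
  obtain ⟨y, a, b, H, hκ⟩ := h
  obtain ⟨ξ, η, ω, h1, h2, h3, h4⟩ := h'
  obtain ⟨γ, g1, g2, -⟩ := (pb_isBipullback t p).exists_hom_of_isLift (R.opfib p.left_mem) b'
    (a'.hom ≫ η ≫ a.inv) (ω ≫ b) (by
      rw [reassoc_of% H'.comp_fill, comp_whiskerRight, comp_whiskerRight, comp_whiskerRight,
        Category.assoc,
        H.comp_fill, reassoc_of% h2]
      simp)
  refine hκ.le ⟨ξ, γ, ?_, ?_, ?_⟩
  · have e : γ ▷ (pb t p).snd ≫ a.hom = a'.hom ≫ η := by simp [g1]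
    have e1 : γ ▷ (pb t p).snd ▷ t.left ≫ a.hom ▷ t.left = a'.hom ▷ t.left ≫ η ▷ t.left := by
      rw [← comp_whiskerRight, e, comp_whiskerRight]
    simp [reassoc_of% e1, h1]
  · simp [h3]
  · have e : b' ▷ p.right ≫ γ ▷ (pb t p).fst ▷ p.right = ω ▷ p.right ≫ b ▷ p.right := by
      rw [← comp_whiskerRight, g2, comp_whiskerRight]
    simp [reassoc_of% e, reassoc_of% h4]

theorem LiftsR.le {κ : q ⟶ (comp s (comp t p)).toSpanDiagram} {c c' : TriCone q s t p}
    (h : LiftsR κ c) (h' : c.Le c') : LiftsR κ c' := by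
  obtain ⟨y', a', b', H'⟩ := (pb_isBipullback t p).exists_isLift (R.opfib p.left_mem) c'.ζ
  exact ⟨y', a', b', H', h.le' h' y' a' b' H'⟩

theorem LiftsL.le' {κ : q ⟶ (comp (comp s t) p).toSpanDiagram} {c c' : TriCone q s t p}
    (h : LiftsL κ c) (h' : c.Le c') (x' a' b') (H' : (pb s t).IsLift c'.θ x' a' b') :
    Lifts κ (c'.coneL x' a' b') := by
  obtain ⟨x, a, b, H, hκ⟩ := h
  obtain ⟨ξ, η, ω, h1, h2, h3, h4⟩ := h'
  obtain ⟨γ, g1, g2, g3⟩ := (pb_isBipullback s t).exists_hom_of_isLift (R.opfib t.left_mem) b'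
    (a'.hom ≫ ξ.inv ≫ a.inv) (η ≫ b) (by
      rw [reassoc_of% H'.comp_fill, comp_whiskerRight, comp_whiskerRight, comp_whiskerRight,
        Category.assoc,
        H.comp_fill, ← h1]
      simp)
  have := g3 inferInstance
  refine hκ.le ⟨(asIso γ).symm, ω, ?_, ?_, ?_⟩
  · have e : η ▷ t.right ≫ b ▷ t.right ≫ inv γ ▷ (pb s t).fst ▷ t.right = b' ▷ t.right := by
      rw [← comp_whiskerRight, ← comp_whiskerRight, ← reassoc_of% g2]
      simp
    simp [reassoc_of% h2, reassoc_of% e]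
  · have e : a.hom = inv (γ ▷ (pb s t).snd) ≫ a'.hom ≫ ξ.inv := by simp [g1]
    simp [e, ← h3]
  · simp [h4]

theorem LiftsL.le {κ : q ⟶ (comp (comp s t) p).toSpanDiagram} {c c' : TriCone q s t p}
    (h : LiftsL κ c) (h' : c.Le c') : LiftsL κ c' := by
  obtain ⟨x', a', b', H'⟩ := (pb_isBipullback s t).exists_isLift (R.opfib t.left_mem) c'.θ
  exact ⟨x', a', b', H', h.le' h' x' a' b' H'⟩

theorem TriCone.Le.refl (c : TriCone q s t p) : c.Le c :=
  ⟨Iso.refl _, 𝟙 _, 𝟙 _, by simp, by simp, by simp, by simp⟩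

theorem liftR_unique {c : TriCone q s t p} {κ κ' : q ⟶ (comp s (comp t p)).toSpanDiagram}
    (h : LiftsR κ c) (h' : LiftsR κ' c) : κ = κ' := by
  obtain ⟨y, a, b, H, hκ⟩ := h
  exact lift_unique hκ (h'.le' (.refl c) y a b H)

theorem liftL_unique {c : TriCone q s t p} {κ κ' : q ⟶ (comp (comp s t) p).toSpanDiagram}
    (h : LiftsL κ c) (h' : LiftsL κ' c) : κ = κ' := by
  obtain ⟨y, a, b, H, hκ⟩ := h
  exact lift_unique hκ (h'.le' (.refl c) y a b H)

abbrev TriCone.pre (j : PreHom q' q) (c : TriCone q s t p) : TriCone q' s t p where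
  x := j.f ≫ c.x
  y := j.f ≫ c.y
  z := j.f ≫ c.z
  θ := (α_ _ _ _).hom ≫ j.f ◁ c.θ ≫ (α_ _ _ _).inv
  ζ := (α_ _ _ _).hom ≫ j.f ◁ c.ζ ≫ (α_ _ _ _).inv
  φ := α_ _ _ _ ≪≫ whiskerLeftIso j.f c.φ ≪≫ j.φ
  σ := j.σ ≫ j.f ◁ c.σ ≫ (α_ _ _ _).inv

theorem LiftsR.pre {κ : q ⟶ (comp s (comp t p)).toSpanDiagram} {c : TriCone q s t p}
    (h : LiftsR κ c) (j : PreHom q' q) :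
    LiftsR ((_root_.Quotient.mk _ j : q' ⟶ q) ≫ κ) (c.pre j) := by
  obtain ⟨y, a, b, H, hκ⟩ := h
  refine ⟨_, _, _, H.pre j.f, (hκ.pre j).le ⟨Iso.refl _, 𝟙 _, ?_, ?_, ?_⟩⟩
  · simp
  · simp
  · simp

theorem LiftsL.pre {κ : q ⟶ (comp (comp s t) p).toSpanDiagram} {c : TriCone q s t p}
    (h : LiftsL κ c) (j : PreHom q' q) :
    LiftsL ((_root_.Quotient.mk _ j : q' ⟶ q) ≫ κ) (c.pre j) := by
  obtain ⟨y, a, b, H, hκ⟩ := h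
  refine ⟨_, _, _, H.pre j.f, (hκ.pre j).le ⟨Iso.refl _, 𝟙 _, ?_, ?_, ?_⟩⟩
  · simp
  · simp
  · simp

theorem TriCone.Le.trans {c c' c'' : TriCone q s t p} (h : c.Le c') (h' : c'.Le c'') :
    c.Le c'' := by
  obtain ⟨ξ, η, ω, h1, h2, h3, h4⟩ := h
  obtain ⟨ξ', η', ω', h1', h2', h3', h4'⟩ := h'
  exact ⟨ξ ≪≫ ξ', η' ≫ η, ω' ≫ ω, by simp [← h1, ← h1'], by simp [h2, reassoc_of% h2'],
    by simp [← h3, ← h3'], by simp [← h4, ← h4']⟩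

noncomputable abbrev triL (s : R.RSpan X Y) (t : R.RSpan Y Z) (p : R.RSpan Z W) :
    TriCone (comp (comp s t) p).toSpanDiagram s t p where
  x := (pb (comp s t) p).snd ≫ (pb s t).snd
  y := (pb (comp s t) p).snd ≫ (pb s t).fst
  z := (pb (comp s t) p).fst
  θ := ((pb s t).fill (pb (comp s t) p).snd).hom
  ζ := (pb (comp s t) p).iso.hom ≫ (α_ _ _ _).inv
  φ := α_ _ _ _
  σ := 𝟙 _

noncomputable abbrev triR (s : R.RSpan X Y) (t : R.RSpan Y Z) (p : R.RSpan Z W) :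
    TriCone (comp s (comp t p)).toSpanDiagram s t p where
  x := (pb s (comp t p)).snd
  y := (pb s (comp t p)).fst ≫ (pb t p).snd
  z := (pb s (comp t p)).fst ≫ (pb t p).fst
  θ := (α_ _ _ _).hom ≫ (pb s (comp t p)).iso.hom
  ζ := ((pb t p).fill (pb s (comp t p)).fst).hom
  φ := Iso.refl _
  σ := (α_ _ _ _).inv

theorem liftsL_id (s : R.RSpan X Y) (t : R.RSpan Y Z) (p : R.RSpan Z W) :
    LiftsL (𝟙 (comp (comp s t) p).toSpanDiagram) (triL s t p) :=
  ⟨(pb (comp s t) p).snd, Iso.refl _, 𝟙 _, by simp [BipullbackCone.IsLift],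
    (lifts_id _ _).le ⟨Iso.refl _, 𝟙 _, by simp, by simp, by simp⟩⟩

theorem liftsR_id (s : R.RSpan X Y) (t : R.RSpan Y Z) (p : R.RSpan Z W) :
    LiftsR (𝟙 (comp s (comp t p)).toSpanDiagram) (triR s t p) :=
  ⟨(pb s (comp t p)).fst, Iso.refl _, 𝟙 _, by simp [BipullbackCone.IsLift],
    (lifts_id _ _).le ⟨Iso.refl _, 𝟙 _, by simp, by simp, by simp⟩⟩

theorem LiftsL.pre_triL_le {k : PreHom q (comp (comp s t) p).toSpanDiagram} {c : TriCone q s t p}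
    (h : LiftsL (_root_.Quotient.mk _ k) c) : ((triL s t p).pre k).Le c := by
  obtain ⟨x, a, b, H, hκ⟩ := h
  obtain ⟨ξ, η, h1, h2, h3⟩ := hκ.rep
  refine ⟨(α_ _ _ _).symm ≪≫ whiskerRightIso ξ _ ≪≫ a, b ≫ ξ.inv ▷ _ ≫ (α_ _ _ _).hom, η,
    ?_, ?_, ?_, ?_⟩
  · unfold BipullbackCone.IsLift at H
    have key : ξ.inv ▷ (pb s t).fst ▷ t.left ≫ ((pb s t).fill (k.f ≫ (pb (comp s t) p).snd)).hom ≫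
        ξ.hom ▷ (pb s t).snd ▷ s.right = ((pb s t).fill x).hom := by
      rw [reassoc_of% (pb s t).fill_naturality ξ.inv]
      simp
    simp at H key
    simp [reassoc_of% key, H]
  · have := h1 =≫ ((α_ _ _ _).inv ≫ ξ.inv ▷ _ ▷ _ ≫ (α_ _ _ _).hom ▷ _)
    simpa using this
  · have := ((α_ _ _ _).hom ≫ k.f ◁ (α_ _ _ _).hom ≫ (α_ _ _ _).inv) ≫= h2
    simpa using this
  · simp at h3
    simp [← h3]

theorem LiftsR.pre_triR_le {k : PreHom q (comp s (comp t p)).toSpanDiagram} {c : TriCone q s t p}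
    (h : LiftsR (_root_.Quotient.mk _ k) c) : ((triR s t p).pre k).Le c := by
  obtain ⟨y, a, b, H, hκ⟩ := h
  obtain ⟨ξ, η, h1, h2, h3⟩ := hκ.rep
  refine ⟨ξ, a.inv ≫ η ▷ _ ≫ (α_ _ _ _).hom, b ≫ η ▷ _ ≫ (α_ _ _ _).hom,
    ?_, ?_, ?_, ?_⟩
  · simp at h1
    simp [h1]
  · unfold BipullbackCone.IsLift at H
    have key := (pb t p).fill_naturality η
    have key' : b ▷ p.left ≫ ((pb t p).fill y).hom = c.ζ ≫ a.inv ▷ t.right := by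
      rw [← H]; simp
    have key'' := (b ▷ p.left ≫= key) =≫ ((α_ _ _ _).hom ▷ t.right)
    simp only [Category.assoc] at key''
    rw [reassoc_of% key'] at key''
    simpa using key''
  · simp at h2
    simp [← h2]
  · have := h3 =≫ ((α_ _ _ _).inv ≫ (α_ _ _ _).hom ▷ _)
    simpa using this

/-- The associativity constraint, induced by the projections to the three apices. -/
noncomputable def assocHom (s : R.RSpan X Y) (t : R.RSpan Y Z) (p : R.RSpan Z W) :
    (comp (comp s t) p).toSpanDiagram ⟶ (comp s (comp t p)).toSpanDiagram :=
  (exists_liftR (triL s t p)).choose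

theorem liftsR_assocHom (s : R.RSpan X Y) (t : R.RSpan Y Z) (p : R.RSpan Z W) :
    LiftsR (assocHom s t p) (triL s t p) := (exists_liftR (triL s t p)).choose_spec

/-- The inverse associativity constraint. -/
noncomputable def assocInv (s : R.RSpan X Y) (t : R.RSpan Y Z) (p : R.RSpan Z W) :
    (comp s (comp t p)).toSpanDiagram ⟶ (comp (comp s t) p).toSpanDiagram :=
  (exists_liftL (triR s t p)).choose

theorem liftsL_assocInv (s : R.RSpan X Y) (t : R.RSpan Y Z) (p : R.RSpan Z W) :
    LiftsL (assocInv s t p) (triR s t p) := (exists_liftL (triR s t p)).choose_spec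

theorem LiftsL.assoc {κ : q ⟶ (comp (comp s t) p).toSpanDiagram} {c : TriCone q s t p}
    (h : LiftsL κ c) : LiftsR (κ ≫ assocHom s t p) c := by
  obtain ⟨k⟩ := κ
  exact ((liftsR_assocHom s t p).pre k).le (LiftsL.pre_triL_le h)

theorem LiftsR.assoc {κ : q ⟶ (comp s (comp t p)).toSpanDiagram} {c : TriCone q s t p}
    (h : LiftsR κ c) : LiftsL (κ ≫ assocInv s t p) c := by
  obtain ⟨k⟩ := κ
  exact ((liftsL_assocInv s t p).pre k).le (LiftsR.pre_triR_le h)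

theorem assoc_hom_inv (s : R.RSpan X Y) (t : R.RSpan Y Z) (p : R.RSpan Z W) :
    assocHom s t p ≫ assocInv s t p = 𝟙 _ :=
  liftL_unique (liftsR_assocHom s t p).assoc (liftsL_id s t p)

theorem assoc_inv_hom (s : R.RSpan X Y) (t : R.RSpan Y Z) (p : R.RSpan Z W) :
    assocInv s t p ≫ assocHom s t p = 𝟙 _ :=
  liftR_unique (liftsL_assocInv s t p).assoc (liftsR_id s t p)

abbrev TriCone.post (c : TriCone q s t p) (m : PreHom s.toSpanDiagram s'.toSpanDiagram)
    (n : PreHom t.toSpanDiagram t'.toSpanDiagram) (o : PreHom p.toSpanDiagram p'.toSpanDiagram) :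
    TriCone q s' t' p' where
  x := c.x ≫ m.f
  y := c.y ≫ n.f
  z := c.z ≫ o.f
  θ := (α_ _ _ _).hom ≫ c.y ◁ n.φ.hom ≫ c.θ ≫ c.x ◁ m.σ ≫ (α_ _ _ _).inv
  ζ := (α_ _ _ _).hom ≫ c.z ◁ o.φ.hom ≫ c.ζ ≫ c.y ◁ n.σ ≫ (α_ _ _ _).inv
  φ := α_ _ _ _ ≪≫ whiskerLeftIso c.x m.φ ≪≫ c.φ
  σ := c.σ ≫ c.z ◁ o.σ ≫ (α_ _ _ _).inv

theorem σ_eq_of_isHom {q : SpanDiagram X Z} {k : PreHom q (comp s t).toSpanDiagram}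
    {c : LaxCone q s t} {ξ η} (h : (coneOf k).IsHom c ξ η) :
    k.σ = c.σ ≫ η ▷ t.right ≫ (α_ _ _ _).hom := by
  have := h.hσ
  simp [reassoc_of% this]

theorem φ_eq_of_isHom {q : SpanDiagram X Z} {k : PreHom q (comp s t).toSpanDiagram}
    {c : LaxCone q s t} {ξ η} (h : (coneOf k).IsHom c ξ η) :
    k.φ.hom = (α_ _ _ _).inv ≫ ξ.hom ▷ s.left ≫ c.φ.hom := by
  have := h.hφ
  simp [this]

theorem isLift_post {Q : C} {x : Q ⟶ s.apex} {y : Q ⟶ t.apex} {θ : y ≫ t.left ⟶ x ≫ s.right}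
    {h : Q ⟶ (pb s t).pt} {a : h ≫ (pb s t).snd ≅ x} {b : y ⟶ h ≫ (pb s t).fst}
    (H : (pb s t).IsLift θ h a b) {m : PreHom s.toSpanDiagram s'.toSpanDiagram}
    {n : PreHom t.toSpanDiagram t'.toSpanDiagram}
    {d : PreHom (comp s t).toSpanDiagram (comp s' t').toSpanDiagram} {ξ η}
    (hd : (coneOf d).IsHom ((unitCone s t).post m n) ξ η) :
    (pb s' t').IsLift (x := x ≫ m.f) (y := y ≫ n.f)
      ((α_ _ _ _).hom ≫ y ◁ n.φ.hom ≫ θ ≫ x ◁ m.σ ≫ (α_ _ _ _).inv)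
      (h ≫ d.f) (α_ _ _ _ ≪≫ whiskerLeftIso h ξ ≪≫ (α_ _ _ _).symm ≪≫ whiskerRightIso a m.f)
      (b ▷ n.f ≫ (α_ _ _ _).hom ≫ h ◁ η ≫ (α_ _ _ _).inv) := by
  obtain ⟨h1, h2, h3⟩ := hd
  unfold BipullbackCone.IsLift at H ⊢
  have := congrArg (fun z => h ◁ z) h1
  simp at this
  have e1 := whisker_exchange b n.φ.hom
  have e2 := whisker_exchange a.hom m.σ
  simp at e1 e2
  simp [← H, reassoc_of% this, reassoc_of% e1, ← reassoc_of% e2]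

theorem LiftsR.post {κ : q ⟶ (comp s (comp t p)).toSpanDiagram} {c : TriCone q s t p}
    (h : LiftsR κ c) (m : PreHom s.toSpanDiagram s'.toSpanDiagram)
    (n : PreHom t.toSpanDiagram t'.toSpanDiagram) (o : PreHom p.toSpanDiagram p'.toSpanDiagram) :
    LiftsR (κ ≫ hcomp (s := s) (s' := s') (t := comp t p) (t' := comp t' p')
      (_root_.Quotient.mk _ m) (hcomp (s := t) (s' := t') (t := p) (t' := p')
        (_root_.Quotient.mk _ n) (_root_.Quotient.mk _ o))) (c.post m n o) := by
  obtain ⟨y, a, b, H, hκ⟩ := h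
  obtain ⟨d, ⟨ξ, η, hd⟩, e⟩ := lifts_hcomp n o
  rw [← e]
  refine ⟨_, _, _, isLift_post H hd, (hκ.post m d).le ⟨Iso.refl _, 𝟙 _, ?_, ?_, ?_⟩⟩
  · simp [φ_eq_of_isHom hd, slide_assoc]
  · simp
  · simp [σ_eq_of_isHom hd, slide'_assoc]

theorem LiftsL.post {κ : q ⟶ (comp (comp s t) p).toSpanDiagram} {c : TriCone q s t p}
    (h : LiftsL κ c) (m : PreHom s.toSpanDiagram s'.toSpanDiagram)
    (n : PreHom t.toSpanDiagram t'.toSpanDiagram) (o : PreHom p.toSpanDiagram p'.toSpanDiagram) :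
    LiftsL (κ ≫ hcomp (s := comp s t) (s' := comp s' t') (t := p) (t' := p')
      (hcomp (s := s) (s' := s') (t := t) (t' := t')
        (_root_.Quotient.mk _ m) (_root_.Quotient.mk _ n)) (_root_.Quotient.mk _ o))
      (c.post m n o) := by
  obtain ⟨y, a, b, H, hκ⟩ := h
  obtain ⟨d, ⟨ξ, η, hd⟩, e⟩ := lifts_hcomp m n
  rw [← e]
  refine ⟨_, _, _, isLift_post H hd, (hκ.post d o).le ⟨Iso.refl _, 𝟙 _, ?_, ?_, ?_⟩⟩
  · simp [σ_eq_of_isHom hd, slide'_assoc]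
  · simp [φ_eq_of_isHom hd, slide_assoc]
  · simp

theorem assocHom_naturality (m : s.toSpanDiagram ⟶ s'.toSpanDiagram)
    (n : t.toSpanDiagram ⟶ t'.toSpanDiagram) (o : p.toSpanDiagram ⟶ p'.toSpanDiagram) :
    hcomp (s := comp s t) (s' := comp s' t') (hcomp m n) o ≫ assocHom s' t' p' =
      assocHom s t p ≫ hcomp (t := comp t p) (t' := comp t' p') m (hcomp n o) := by
  obtain ⟨m⟩ := m
  obtain ⟨n⟩ := n
  obtain ⟨o⟩ := o
  refine liftR_unique (c := (triL s t p).post m n o) ?_ ((liftsR_assocHom s t p).post m n o)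
  have := ((liftsL_id s t p).post m n o).assoc
  rwa [Category.id_comp] at this

end

section unitors
variable {s s' : R.RSpan X Y}

/-- The datum inducing the inverse of the left unitor. -/
abbrev leftCone (s : R.RSpan X Y) : LaxCone s.toSpanDiagram (id R X) s where
  x := s.left
  y := 𝟙 _
  θ := (λ_ _).hom ≫ (ρ_ _).inv
  φ := ρ_ _
  σ := (λ_ _).inv

/-- The datum inducing the inverse of the right unitor. -/
abbrev rightCone (s : R.RSpan X Y) : LaxCone s.toSpanDiagram s (id R Y) where
  x := 𝟙 _
  y := s.right
  θ := (ρ_ _).hom ≫ (λ_ _).inv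
  φ := λ_ _
  σ := (ρ_ _).inv

noncomputable def leftInv (s : R.RSpan X Y) : s.toSpanDiagram ⟶ (comp (id R X) s).toSpanDiagram :=
  lift (leftCone s)

noncomputable def rightInv (s : R.RSpan X Y) : s.toSpanDiagram ⟶ (comp s (id R Y)).toSpanDiagram :=
  lift (rightCone s)

noncomputable abbrev leftPre (s : R.RSpan X Y) :
    PreHom (comp (id R X) s).toSpanDiagram s.toSpanDiagram where
  f := (pb (id R X) s).fst
  φ := (pb (id R X) s).iso
  σ := 𝟙 _

noncomputable abbrev rightPre (s : R.RSpan X Y) :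
    PreHom (comp s (id R Y)).toSpanDiagram s.toSpanDiagram where
  f := (pb s (id R Y)).snd
  φ := Iso.refl _
  σ := (pb s (id R Y)).iso.hom

noncomputable def leftHom (s : R.RSpan X Y) : (comp (id R X) s).toSpanDiagram ⟶ s.toSpanDiagram :=
  _root_.Quotient.mk _ (leftPre s)

noncomputable def rightHom (s : R.RSpan X Y) : (comp s (id R Y)).toSpanDiagram ⟶ s.toSpanDiagram :=
  _root_.Quotient.mk _ (rightPre s)

theorem left_inv_hom (s : R.RSpan X Y) : leftInv s ≫ leftHom s = 𝟙 _ := by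
  obtain ⟨k, ⟨ξ, η, hd⟩, e⟩ := lifts_lift (leftCone s)
  rw [leftInv, ← e]
  have h1 := hd.hθ
  have : IsIso η := by
    refine Protocalibration.isIso_of_isLift (pb (id R X) s) (R.opfib s.left_mem) (a := ξ)
      (θ := (λ_ s.left).hom ≫ (ρ_ s.left).inv) h1
  refine _root_.Quotient.sound ⟨(asIso η).symm, ?_, ?_⟩
  · simp [φ_eq_of_isHom hd]
    simp at h1
    rw [← cancel_mono (ρ_ s.left).inv, ← cancel_epi (η ▷ s.left)]
    simp [h1]
  · simp [σ_eq_of_isHom hd]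

theorem left_hom_inv (s : R.RSpan X Y) : leftHom s ≫ leftInv s = 𝟙 _ := by
  refine lift_unique (((lifts_lift (leftCone s)).pre (leftPre s)).le
    ⟨(pb (id R X) s).iso ≪≫ ρ_ _, (ρ_ _).inv, ?_, ?_, ?_⟩) (lifts_id _ _)
  · simp
  · simp
  · simp

theorem right_inv_hom (s : R.RSpan X Y) : rightInv s ≫ rightHom s = 𝟙 _ := by
  obtain ⟨k, ⟨ξ, η, hd⟩, e⟩ := lifts_lift (rightCone s)
  rw [rightInv, ← e]
  have h1 := hd.hθ
  refine _root_.Quotient.sound ⟨ξ, ?_, ?_⟩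
  · simp [φ_eq_of_isHom hd]
  · simp [σ_eq_of_isHom hd]
    simpa using h1

theorem right_hom_inv (s : R.RSpan X Y) : rightHom s ≫ rightInv s = 𝟙 _ := by
  refine lift_unique (((lifts_lift (rightCone s)).pre (rightPre s)).le
    ⟨ρ_ _, (ρ_ _).inv ≫ (pb s (id R Y)).iso.hom, ?_, ?_, ?_⟩) (lifts_id _ _)
  · simp
  · simp
  · simp

theorem leftInv_naturality (m : s.toSpanDiagram ⟶ s'.toSpanDiagram) :
    m ≫ leftInv s' = leftInv s ≫ hcomp (s := id R X) (s' := id R X) (𝟙 _) m := by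
  obtain ⟨m⟩ := m
  refine lift_unique (((lifts_lift (leftCone s')).pre m).le ⟨m.φ ≪≫ (ρ_ _).symm,
    (λ_ _).hom ≫ (ρ_ _).inv, ?_, ?_, ?_⟩) ((lifts_lift (leftCone s)).post (PreHom.id _) m)
  · simp
  · simp
  · simp

theorem rightInv_naturality (m : s.toSpanDiagram ⟶ s'.toSpanDiagram) :
    m ≫ rightInv s' = rightInv s ≫ hcomp (t := id R Y) (t' := id R Y) m (𝟙 _) := by
  obtain ⟨m⟩ := m
  refine lift_unique (((lifts_lift (rightCone s')).pre m).le ⟨ρ_ _ ≪≫ (λ_ _).symm,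
    (ρ_ _).hom ≫ m.σ, ?_, ?_, ?_⟩) ((lifts_lift (rightCone s)).post m (PreHom.id _))
  · simp
  · simp
  · simp

noncomputable abbrev triangleCone (s : R.RSpan X Y) (t : R.RSpan Y Z) :
    TriCone (comp s t).toSpanDiagram s (id R Y) t where
  x := (pb s t).snd
  y := (pb s t).snd ≫ s.right
  z := (pb s t).fst
  θ := (ρ_ _).hom
  ζ := (pb s t).iso.hom ≫ (ρ_ _).inv
  φ := Iso.refl _
  σ := 𝟙 _

theorem triangle_inv (s : R.RSpan X Y) (t : R.RSpan Y Z) :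
    hcomp (s' := comp s (id R Y)) (t' := t) (rightInv s) (𝟙 t.toSpanDiagram) ≫
      assocHom s (id R Y) t =
      hcomp (s' := s) (t' := comp (id R Y) t) (𝟙 s.toSpanDiagram) (leftInv t) := by
  obtain ⟨k, ⟨ξ, η, hd⟩, e⟩ := lifts_lift (rightCone s)
  obtain ⟨l, ⟨ξ', η', hd'⟩, e'⟩ := lifts_lift (leftCone t)
  rw [leftInv, rightInv, ← e, ← e']
  refine liftR_unique (c := triangleCone s t) (LiftsL.assoc ?_) ?_
  · refine ⟨(pb s t).snd ≫ k.f, α_ _ _ _ ≪≫ whiskerLeftIso _ ξ ≪≫ ρ_ _, _ ◁ η ≫ (α_ _ _ _).inv, ?_,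
      (lifts_hcomp k (PreHom.id _)).le ⟨Iso.refl _, (ρ_ _).inv, ?_, ?_, ?_⟩⟩
    · have h1 := congrArg (fun z => (α_ _ _ _).hom ≫ (pb s t).snd ◁ (z ≫ (λ_ _).hom)) hd.hθ
      simp only [BipullbackCone.IsLift]
      refine Eq.trans ?_ (h1.trans ?_)
      · simp only [Iso.trans_hom, whiskerLeftIso_hom, Iso.symm_hom]
        bicategory
      · simp
    · simp [σ_eq_of_isHom hd]
    · simp [φ_eq_of_isHom hd]
    · simp
  · refine ⟨(pb s t).fst ≫ l.f, α_ _ _ _ ≪≫ whiskerLeftIso _ ξ' ≪≫ (pb s t).iso,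
      (ρ_ _).inv ≫ _ ◁ η' ≫ (α_ _ _ _).inv, ?_,
      (lifts_hcomp (PreHom.id _) l).le ⟨ρ_ _, 𝟙 _, ?_, ?_, ?_⟩⟩
    · have h1 := congrArg (fun z => (pb s t).fst ◁ ((λ_ _).inv ≫ z ≫ (ρ_ _).hom) ≫
        (pb s t).iso.hom ≫ (ρ_ _).inv) hd'.hθ
      simp only [BipullbackCone.IsLift]
      refine Eq.trans ?_ (h1.trans ?_)
      · simp only [Iso.trans_hom, whiskerLeftIso_hom, Iso.symm_hom]
        bicategory
      · simp
    · simp [φ_eq_of_isHom hd']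
    · simp
    · simp [σ_eq_of_isHom hd']

end unitors

section pentagon
variable {V : C} {s : R.RSpan X Y} {t : R.RSpan Y Z} {p : R.RSpan Z W}

noncomputable abbrev LaxCone.tri {q : R.RSpan X Z} (L : LaxCone q.toSpanDiagram s t)
    (k : R.RSpan Z W) : TriCone (comp q k).toSpanDiagram s t k where
  x := (pb q k).snd ≫ L.x
  y := (pb q k).snd ≫ L.y
  z := (pb q k).fst
  θ := (α_ _ _ _).hom ≫ (pb q k).snd ◁ L.θ ≫ (α_ _ _ _).inv
  ζ := (pb q k).iso.hom ≫ (pb q k).snd ◁ L.σ ≫ (α_ _ _ _).inv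
  φ := α_ _ _ _ ≪≫ whiskerLeftIso (pb q k).snd L.φ
  σ := 𝟙 _

theorem Lifts.tri {q : R.RSpan X Z} {κ : q.toSpanDiagram ⟶ (comp s t).toSpanDiagram}
    {L : LaxCone q.toSpanDiagram s t} (h : Lifts κ L) (k : R.RSpan Z W) :
    LiftsL (hcomp (s := q) (s' := comp s t) κ (𝟙 k.toSpanDiagram)) (L.tri k) := by
  obtain ⟨d, ⟨ξ, η, hd⟩, rfl⟩ := h
  refine ⟨(pb q k).snd ≫ d.f, α_ _ _ _ ≪≫ whiskerLeftIso _ ξ, _ ◁ η ≫ (α_ _ _ _).inv, ?_,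
    (lifts_hcomp d (PreHom.id _)).le ⟨Iso.refl _, (ρ_ _).inv, ?_, ?_, ?_⟩⟩
  · have := congrArg (fun z => (pb q k).snd ◁ z) hd.hθ
    simp at this
    simp [BipullbackCone.IsLift, reassoc_of% this]
  · simp [σ_eq_of_isHom hd]
  · simp [φ_eq_of_isHom hd]
  · simp

noncomputable abbrev midDiagram (s : R.RSpan X Y) (t : R.RSpan Y Z) (p : R.RSpan Z W) (k : R.RSpan W V) :
    SpanDiagram Y V where
  apex := (comp (comp (comp s t) p) k).apex
  left := ((pb (comp (comp s t) p) k).snd ≫ (triL s t p).y) ≫ t.left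
  right := (comp (comp (comp s t) p) k).right

noncomputable abbrev midCone (s : R.RSpan X Y) (t : R.RSpan Y Z) (p : R.RSpan Z W)
    (k : R.RSpan W V) : TriCone (midDiagram s t p k) t p k where
  x := (pb (comp (comp s t) p) k).snd ≫ (triL s t p).y
  y := (pb (comp (comp s t) p) k).snd ≫ (triL s t p).z
  z := (pb (comp (comp s t) p) k).fst
  θ := (α_ _ _ _).hom ≫ (pb (comp (comp s t) p) k).snd ◁ (triL s t p).ζ ≫ (α_ _ _ _).inv
  ζ := (pb (comp (comp s t) p) k).iso.hom ≫ (α_ _ _ _).inv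
  φ := Iso.refl _
  σ := 𝟙 _

noncomputable abbrev pentCone (s : R.RSpan X Y) (t : R.RSpan Y Z) (p : R.RSpan Z W)
    (k : R.RSpan W V) (y : (midDiagram s t p k).apex ⟶ (comp p k).apex)
    (a : y ≫ (pb p k).snd ≅ (midCone s t p k).y) (b : (midCone s t p k).z ⟶ y ≫ (pb p k).fst) :
    TriCone (comp (comp (comp s t) p) k).toSpanDiagram s t (comp p k) where
  x := (pb (comp (comp s t) p) k).snd ≫ (triL s t p).x
  y := (pb (comp (comp s t) p) k).snd ≫ (triL s t p).y
  z := y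
  θ := (α_ _ _ _).hom ≫ (pb (comp (comp s t) p) k).snd ◁ (triL s t p).θ ≫ (α_ _ _ _).inv
  ζ := ((midCone s t p k).coneR y a b).θ
  φ := α_ _ _ _ ≪≫ whiskerLeftIso _ (triL s t p).φ
  σ := ((midCone s t p k).coneR y a b).σ

theorem pentagon (s : R.RSpan X Y) (t : R.RSpan Y Z) (p : R.RSpan Z W) (k : R.RSpan W V) :
    hcomp (s := comp (comp s t) p) (s' := comp s (comp t p)) (assocHom s t p)
      (𝟙 k.toSpanDiagram) ≫ assocHom s (comp t p) k ≫
      hcomp (t := comp (comp t p) k) (t' := comp t (comp p k)) (𝟙 s.toSpanDiagram)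
        (assocHom t p k) =
    assocHom (comp s t) p k ≫ assocHom s t (comp p k) := by
  obtain ⟨y1, a1, b1, H1, h1⟩ := liftsR_assocHom s t p
  obtain ⟨y2, a2, b2, H2, h2⟩ := (h1.tri k).assoc
  let Y2 : PreHom (midDiagram s t p k) (comp (comp t p) k).toSpanDiagram :=
    { f := y2
      φ := (α_ _ _ _).symm ≪≫ (α_ _ _ _).symm ≪≫ whiskerRightIso (whiskerRightIso a2 _ ≪≫
        α_ _ _ _ ≪≫ whiskerLeftIso _ a1) _
      σ := b2 ▷ _ ≫ (α_ _ _ _).hom }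
  have h3 : LiftsL (_root_.Quotient.mk _ Y2 : midDiagram s t p k ⟶ _) (midCone s t p k) := by
    refine ⟨_, _, _, H1.pre (pb (comp (comp s t) p) k).snd, (lifts_coneOf Y2).le
      ⟨a2, b2, ?_, ?_, ?_⟩⟩
    · have h5 := H2
      simp [BipullbackCone.IsLift] at h5
      simp [Y2]
      exact h5
    · simp [Y2]
    · simp [Y2]
  obtain ⟨y3, a3, b3, H3, h4⟩ := h3.assoc
  obtain ⟨d, ed⟩ : ∃ d, _root_.Quotient.mk _ d = assocHom t p k :=
    _root_.Quotient.exists_rep (assocHom t p k)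
  rw [← ed] at h4 ⊢
  obtain ⟨ξ, η, hd⟩ := Lifts.rep (k := Y2.comp d) h4
  refine liftR_unique (c := pentCone s t p k y3 a3 b3) ?_ (LiftsL.assoc ?_)
  · rw [← Category.assoc]
    refine ⟨y2 ≫ d.f, ξ, η, hd.hθ, (h2.post (PreHom.id _) d).le ⟨ρ_ _, 𝟙 _, ?_, ?_, ?_⟩⟩
    · have h6 := hd.hφ
      simp [Y2] at h6
      simp [reassoc_of% h6]
    · simp only [Iso.trans_hom, whiskerLeftIso_hom]
      bicategory
    · have h6 := hd.hσ
      simp [Y2] at h6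
      simp [reassoc_of% h6]
  · have := (liftsR_assocHom (comp s t) p k).le' (.refl _) y3 a3 b3 H3
    refine ⟨(pb (comp (comp s t) p) k).snd ≫ (pb (comp s t) p).snd, α_ _ _ _, (α_ _ _ _).inv, ?_,
      this.le ⟨Iso.refl _, 𝟙 _, ?_, ?_, ?_⟩⟩
    · simp [BipullbackCone.IsLift]
    · simp
    · simp
    · simp

end pentagon

/-- The category of `R`-spans from `X` to `Y` and 2-cells between them. -/
instance category : Category (R.RSpan X Y) where
  Hom s t := s.toSpanDiagram ⟶ t.toSpanDiagram
  id s := 𝟙 s.toSpanDiagram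
  comp m n := CategoryStruct.comp (obj := SpanDiagram X Y) m n
  id_comp m := Category.id_comp (obj := SpanDiagram X Y) m
  comp_id m := Category.comp_id (obj := SpanDiagram X Y) m
  assoc m n o := Category.assoc (obj := SpanDiagram X Y) m n o

noncomputable def associator (s : R.RSpan X Y) (t : R.RSpan Y Z) (p : R.RSpan Z W) :
    comp (comp s t) p ≅ comp s (comp t p) where
  hom := assocHom s t p
  inv := assocInv s t p
  hom_inv_id := assoc_hom_inv s t p
  inv_hom_id := assoc_inv_hom s t p

noncomputable def leftUnitor (s : R.RSpan X Y) : comp (id R X) s ≅ s where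
  hom := leftHom s
  inv := leftInv s
  hom_inv_id := left_hom_inv s
  inv_hom_id := left_inv_hom s

noncomputable def rightUnitor (s : R.RSpan X Y) : comp s (id R Y) ≅ s where
  hom := rightHom s
  inv := rightInv s
  hom_inv_id := right_hom_inv s
  inv_hom_id := right_inv_hom s

/-- Horizontal composition of 2-cells, for the category structure on `R`-spans. -/
noncomputable def hc {s s' : R.RSpan X Y} {t t' : R.RSpan Y Z} (m : s ⟶ s') (n : t ⟶ t') :
    comp s t ⟶ comp s' t' := hcomp m n

theorem hc_id (s : R.RSpan X Y) (t : R.RSpan Y Z) : hc (𝟙 s) (𝟙 t) = 𝟙 (comp s t) := hcomp_id s t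

theorem hc_comp {s s' s'' : R.RSpan X Y} {t t' t'' : R.RSpan Y Z} (m : s ⟶ s') (m' : s' ⟶ s'')
    (n : t ⟶ t') (n' : t' ⟶ t'') : hc (m ≫ m') (n ≫ n') = hc m n ≫ hc m' n' :=
  hcomp_comp m m' n n'

theorem hc_assoc {s s' : R.RSpan X Y} {t t' : R.RSpan Y Z} {p p' : R.RSpan Z W} (m : s ⟶ s')
    (n : t ⟶ t') (o : p ⟶ p') :
    hc (hc m n) o ≫ (associator s' t' p').hom = (associator s t p).hom ≫ hc m (hc n o) :=
  assocHom_naturality m n o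

theorem hc_leftInv {s s' : R.RSpan X Y} (m : s ⟶ s') :
    m ≫ (leftUnitor s').inv = (leftUnitor s).inv ≫ hc (𝟙 (id R X)) m := leftInv_naturality m

theorem hc_rightInv {s s' : R.RSpan X Y} (m : s ⟶ s') :
    m ≫ (rightUnitor s').inv = (rightUnitor s).inv ≫ hc m (𝟙 (id R Y)) := rightInv_naturality m

theorem hc_triangle (s : R.RSpan X Y) (t : R.RSpan Y Z) :
    hc (rightUnitor s).inv (𝟙 t) ≫ (associator s (id R Y) t).hom = hc (𝟙 s) (leftUnitor t).inv :=
  triangle_inv s t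

theorem hc_pentagon {V : C} (s : R.RSpan X Y) (t : R.RSpan Y Z) (p : R.RSpan Z W)
    (k : R.RSpan W V) :
    hc (associator s t p).hom (𝟙 k) ≫ (associator s (comp t p) k).hom ≫
      hc (𝟙 s) (associator t p k).hom =
    (associator (comp s t) p k).hom ≫ (associator s t (comp p k)).hom := pentagon s t p k

theorem hc_left_comp (s : R.RSpan X Y) {t t' t'' : R.RSpan Y Z} (n : t ⟶ t') (n' : t' ⟶ t'') :
    hc (𝟙 s) (n ≫ n') = hc (𝟙 s) n ≫ hc (𝟙 s) n' := by
  rw [← hc_comp, Category.id_comp]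

theorem hc_right_comp {s s' s'' : R.RSpan X Y} (m : s ⟶ s') (m' : s' ⟶ s'') (t : R.RSpan Y Z) :
    hc (m ≫ m') (𝟙 t) = hc m (𝟙 t) ≫ hc m' (𝟙 t) := by
  rw [← hc_comp, Category.id_comp]

theorem hc_id_left {s s' : R.RSpan X Y} (m : s ⟶ s') :
    hc (𝟙 (id R X)) m = (leftUnitor s).hom ≫ m ≫ (leftUnitor s').inv := by
  rw [hc_leftInv, Iso.hom_inv_id_assoc]

theorem hc_id_right {s s' : R.RSpan X Y} (m : s ⟶ s') :
    hc m (𝟙 (id R Y)) = (rightUnitor s).hom ≫ m ≫ (rightUnitor s').inv := by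
  rw [hc_rightInv, Iso.hom_inv_id_assoc]

theorem hc_comp_left (s : R.RSpan X Y) (t : R.RSpan Y Z) {p p' : R.RSpan Z W} (o : p ⟶ p') :
    hc (𝟙 (comp s t)) o =
      (associator s t p).hom ≫ hc (𝟙 s) (hc (𝟙 t) o) ≫ (associator s t p').inv := by
  rw [← Category.assoc, ← hc_assoc, Category.assoc, Iso.hom_inv_id, Category.comp_id, hc_id]

theorem hc_comp_right {s s' : R.RSpan X Y} (m : s ⟶ s') (t : R.RSpan Y Z) (p : R.RSpan Z W) :
    hc m (𝟙 (comp t p)) =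
      (associator s t p).inv ≫ hc (hc m (𝟙 t)) (𝟙 p) ≫ (associator s' t p).hom := by
  rw [hc_assoc, Iso.inv_hom_id_assoc, hc_id]

theorem hc_mid (s : R.RSpan X Y) {t t' : R.RSpan Y Z} (n : t ⟶ t') (p : R.RSpan Z W) :
    hc (hc (𝟙 s) n) (𝟙 p) =
      (associator s t p).hom ≫ hc (𝟙 s) (hc n (𝟙 p)) ≫ (associator s t' p).inv := by
  rw [← Category.assoc, ← hc_assoc, Category.assoc, Iso.hom_inv_id, Category.comp_id]

theorem hc_exchange {s s' : R.RSpan X Y} {t t' : R.RSpan Y Z} (m : s ⟶ s') (n : t ⟶ t') :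
    hc (𝟙 s) n ≫ hc m (𝟙 t') = hc m (𝟙 t) ≫ hc (𝟙 s') n := by
  rw [← hc_comp, ← hc_comp, Category.id_comp, Category.comp_id, Category.id_comp, Category.comp_id]

theorem hc_triangle' (s : R.RSpan X Y) (t : R.RSpan Y Z) :
    (associator s (id R Y) t).hom ≫ hc (𝟙 s) (leftUnitor t).hom = hc (rightUnitor s).hom (𝟙 t) := by
  have h1 : hc (rightUnitor s).hom (𝟙 t) ≫ hc (rightUnitor s).inv (𝟙 t) = 𝟙 _ := by
    rw [← hc_right_comp, Iso.hom_inv_id, hc_id]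
  have h2 : hc (𝟙 s) (leftUnitor t).inv ≫ hc (𝟙 s) (leftUnitor t).hom = 𝟙 _ := by
    rw [← hc_left_comp, Iso.inv_hom_id, hc_id]
  have h3 := congrArg (fun z => hc (rightUnitor s).hom (𝟙 t) ≫ z ≫ hc (𝟙 s) (leftUnitor t).hom)
    (hc_triangle s t)
  simp only [h2, Category.comp_id] at h3
  rw [← h3, Category.assoc, ← Category.assoc, h1, Category.id_comp]

end RSpan

/-- The objects of the bicategory of `R`-spans: those of `C`. -/
structure Spn {C : Type u} [Bicategory.{w, v} C] (R : Protocalibration C) where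
  base : C

open RSpan in
/-- The bicategory of `R`-spans: 1-cells from `X` to `Y` are the `R`-spans, 2-cells are isomorphism
classes of 2-cells of spans, and composition is by bipullback. -/
noncomputable instance Spn.bicategory {C : Type u} [Bicategory.{w, v} C] (R : Protocalibration C) :
    Bicategory.{max v w, max u v} (Spn R) where
  Hom X Y := R.RSpan X.base Y.base
  id X := RSpan.id R X.base
  comp s t := RSpan.comp s t
  homCategory X Y := inferInstanceAs (Category (R.RSpan X.base Y.base))
  whiskerLeft s _ _ n := hc (𝟙 s) n
  whiskerRight m t := hc m (𝟙 t)
  associator s t p := RSpan.associator s t p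
  leftUnitor s := RSpan.leftUnitor s
  rightUnitor s := RSpan.rightUnitor s
  whiskerLeft_id s t := hc_id s t
  whiskerLeft_comp s _ _ _ n n' := hc_left_comp s n n'
  id_whiskerLeft m := hc_id_left m
  comp_whiskerLeft s t _ _ o := hc_comp_left s t o
  id_whiskerRight s t := hc_id s t
  comp_whiskerRight m m' t := hc_right_comp m m' t
  whiskerRight_id m := hc_id_right m
  whiskerRight_comp m t p := hc_comp_right m t p
  whisker_assoc s _ _ n p := hc_mid s n p
  whisker_exchange m n := hc_exchange m n
  pentagon s t p k := hc_pentagon s t p k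
  triangle s t := hc_triangle' s t


/-- The objects over `U` by a 1-cell in `R`: objects of the value at `U` of the `R`-cocompletion of the
terminal `C`-variable category. -/
structure RSlice {C : Type u} [Bicategory.{w, v} C] (R : Protocalibration C) (U : C) where
  dom : C
  hom : dom ⟶ U
  hom_mem : R.mem hom

namespace RSlice
variable {C : Type u} [Bicategory.{w, v} C] {R : Protocalibration C} {U V : C}

/-- A representative of a morphism over `U`. -/
structure PreHom (s t : RSlice R U) where
  f : s.dom ⟶ t.dom
  φ : f ≫ t.hom ≅ s.hom

namespace PreHom

abbrev id (s : RSlice R U) : PreHom s s := ⟨𝟙 _, λ_ _⟩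

abbrev comp {s t r : RSlice R U} (m : PreHom s t) (n : PreHom t r) : PreHom s r where
  f := m.f ≫ n.f
  φ := α_ _ _ _ ≪≫ whiskerLeftIso m.f n.φ ≪≫ m.φ

/-- Isomorphism of representatives. -/
def Rel {s t : RSlice R U} (m n : PreHom s t) : Prop :=
  ∃ γ : m.f ≅ n.f, γ.hom ▷ t.hom ≫ n.φ.hom = m.φ.hom

def setoid (s t : RSlice R U) : Setoid (PreHom s t) where
  r := Rel
  iseqv :=
    { refl := fun m => ⟨Iso.refl _, by simp⟩
      symm := by
        rintro m n ⟨γ, h1⟩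
        exact ⟨γ.symm, by simp [← h1]⟩
      trans := by
        rintro m n k ⟨γ, h1⟩ ⟨δ, h3⟩
        exact ⟨γ ≪≫ δ, by simp [h1, h3]⟩ }

theorem comp_rel {s t r : RSlice R U} {m m' : PreHom s t} {n n' : PreHom t r}
    (hm : Rel m m') (hn : Rel n n') : Rel (m.comp n) (m'.comp n') := by
  obtain ⟨γ, h1⟩ := hm
  obtain ⟨δ, h3⟩ := hn
  refine ⟨whiskerRightIso γ n.f ≪≫ whiskerLeftIso m'.f δ, ?_⟩
  have := slide_assoc γ.hom (δ.hom ▷ r.hom ≫ n'.φ.hom) m'.φ.hom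
  simp at this
  simp [← h1, ← h3, this]

end PreHom

/-- Morphisms over `U`: isomorphism classes of triangles commuting up to an invertible 2-cell. -/
def Hom (s t : RSlice R U) := _root_.Quotient (PreHom.setoid s t)

instance : Category (RSlice R U) where
  Hom := Hom
  id s := _root_.Quotient.mk _ (PreHom.id s)
  comp := _root_.Quotient.map₂ PreHom.comp (fun _ _ h _ _ h' => PreHom.comp_rel h h')
  id_comp := by
    rintro s t ⟨m⟩
    exact _root_.Quotient.sound ⟨λ_ _, by simp⟩
  comp_id := by
    rintro s t ⟨m⟩
    exact _root_.Quotient.sound ⟨ρ_ _, by simp⟩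
  assoc := by
    rintro s t r q ⟨m⟩ ⟨n⟩ ⟨k⟩
    exact _root_.Quotient.sound ⟨α_ _ _ _, by simp⟩

noncomputable abbrev pb (g : V ⟶ U) (s : RSlice R U) : BipullbackCone s.hom g :=
  R.pullback s.hom s.hom_mem g

/-- Bipullback along `g` on objects. -/
noncomputable abbrev pullbackObj (g : V ⟶ U) (s : RSlice R U) : RSlice R V where
  dom := (pb g s).pt
  hom := (pb g s).snd
  hom_mem := R.pullback_snd_mem _ _ _

/-- `k` is a morphism between bipullbacks along `g` that is compatible with `m`. -/
def PreHom.IsPullback (g : V ⟶ U) {s t : RSlice R U} (m : PreHom s t)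
    (k : PreHom (pullbackObj g s) (pullbackObj g t)) : Prop :=
  ∃ i : k.f ≫ (pb g t).fst ≅ (pb g s).fst ≫ m.f,
    ((pb g t).fill k.f).hom ≫ k.φ.hom ▷ g =
      i.hom ▷ t.hom ≫ (α_ _ _ _).hom ≫ (pb g s).fst ◁ m.φ.hom ≫ (pb g s).iso.hom

theorem PreHom.exists_isPullback (g : V ⟶ U) {s t : RSlice R U} (m : PreHom s t) :
    ∃ k, m.IsPullback g k := by
  obtain ⟨h, i, j, w⟩ := (R.pullback_isBipullback t.hom t.hom_mem g).exists_lift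
    ((pb g s).fst ≫ m.f) (pb g s).snd
    (α_ _ _ _ ≪≫ whiskerLeftIso _ m.φ ≪≫ (pb g s).iso)
  exact ⟨⟨h, j⟩, i, by simpa using w.symm⟩

theorem PreHom.IsPullback.rel {g : V ⟶ U} {s t : RSlice R U} {m m' : PreHom s t}
    {k k' : PreHom (pullbackObj g s) (pullbackObj g t)} (h : m.IsPullback g k)
    (h' : m'.IsPullback g k') (hm : Rel m m') : Rel k k' := by
  obtain ⟨i, hi⟩ := h
  obtain ⟨i', hi'⟩ := h'
  obtain ⟨γ, hγ⟩ := hm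
  obtain ⟨δ, h1, h2, h3⟩ := (R.pullback_isBipullback t.hom t.hom_mem g).exists_hom
    (i.hom ≫ (pb g s).fst ◁ γ.hom ≫ i'.inv) (k.φ.hom ≫ k'.φ.inv) (by
      have e : ((pb g t).fill k'.f).hom = i'.hom ▷ t.hom ≫ (α_ _ _ _).hom ≫
          (pb g s).fst ◁ m'.φ.hom ≫ (pb g s).iso.hom ≫ k'.φ.inv ▷ g := by
        have := hi' =≫ (k'.φ.inv ▷ g)
        simp only [Category.assoc, hom_inv_whiskerRight, Category.comp_id] at this
        exact this
      have e' := hi =≫ (k'.φ.inv ▷ g)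
      simp only [Category.assoc] at e'
      rw [comp_whiskerRight k.φ.hom, e', e, ← hγ]
      simp)
  have := h3 inferInstance inferInstance
  exact ⟨asIso δ, by simp [h2]⟩

/-- Bipullback along `g` on morphisms: the unique class compatible with the given one. -/
noncomputable def pullbackMap (g : V ⟶ U) {s t : RSlice R U} :
    (s ⟶ t) → (pullbackObj g s ⟶ pullbackObj g t) :=
  _root_.Quotient.map (fun m : PreHom s t => (m.exists_isPullback g).choose)
    (fun m m' h => (m.exists_isPullback g).choose_spec.rel (m'.exists_isPullback g).choose_spec h)

theorem pullbackMap_mk {g : V ⟶ U} {s t : RSlice R U} {m : PreHom s t}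
    {k : PreHom (pullbackObj g s) (pullbackObj g t)} (h : m.IsPullback g k) :
    pullbackMap g (_root_.Quotient.mk _ m) = _root_.Quotient.mk _ k :=
  _root_.Quotient.sound ((m.exists_isPullback g).choose_spec.rel h ((PreHom.setoid s t).refl m))

/-- The functor from `R`-objects over `U` to `R`-objects over `V` given by bipullback along
`g : V ⟶ U`. -/
noncomputable def pullback (R : Protocalibration C) (g : V ⟶ U) : RSlice R U ⥤ RSlice R V where
  obj := pullbackObj g
  map := pullbackMap g
  map_id s := by
    refine pullbackMap_mk (k := PreHom.id _) ⟨λ_ _ ≪≫ (ρ_ _).symm, ?_⟩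
    simp
  map_comp := by
    rintro s t r ⟨m⟩ ⟨n⟩
    obtain ⟨k, hk⟩ := m.exists_isPullback g
    obtain ⟨l, hl⟩ := n.exists_isPullback g
    have e1 := pullbackMap_mk hk
    have e2 := pullbackMap_mk hl
    have e3 : (m.comp n).IsPullback g (k.comp l) → pullbackMap g (_root_.Quotient.mk _ (m.comp n)) =
        pullbackMap g (_root_.Quotient.mk _ m : s ⟶ t) ≫
          pullbackMap g (_root_.Quotient.mk _ n : t ⟶ r) := by
      intro h
      rw [e1, e2]
      exact pullbackMap_mk h
    refine e3 ?_
    obtain ⟨i, hi⟩ := hk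
    obtain ⟨j, hj⟩ := hl
    refine ⟨α_ _ _ _ ≪≫ whiskerLeftIso _ j ≪≫ (α_ _ _ _).symm ≪≫ whiskerRightIso i _ ≪≫
      α_ _ _ _, ?_⟩
    have h1 := congrArg (fun z => k.f ◁ z) hj
    have h2 := slide_assoc i.hom n.φ.hom
      ((α_ _ _ _).hom ≫ (pb g s).fst ◁ m.φ.hom ≫ (pb g s).iso.hom)
    rw [← hi] at h2
    simp at h1 h2
    have h3 := ((α_ (k.f ≫ l.f) (pb g r).fst r.hom).hom ≫
      (α_ k.f l.f ((pb g r).fst ≫ r.hom)).hom ≫ k.f ◁ (α_ _ _ _).inv) ≫= h1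
    simp at h3
    simp [h2, reassoc_of% h3]

end RSlice

section bicoproducts

/-- `Z` is bi-initial: each hom-category out of `Z` is equivalent to the terminal category. -/
def IsBiinitial {B : Type u} [Bicategory.{w, v} B] (Z : B) : Prop :=
  ∀ W : B, (Functor.star.{0} (Z ⟶ W)).IsEquivalence

/-- `i`, `j` exhibit `D` as a bicoproduct of `U` and `V`: restriction along `i` and `j` is an
equivalence from `B(D, W)` to `B(U, W) × B(V, W)` for every `W`. -/
def IsBinaryBicoproduct {B : Type u} [Bicategory.{w, v} B] {U V D : B} (i : U ⟶ D) (j : V ⟶ D) :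
    Prop :=
  ∀ W : B, ((precomp W i).prod' (precomp W j)).IsEquivalence

/-- A bicategory has finite bicoproducts: it has a bi-initial object and binary bicoproducts. -/
structure HasFiniteBicoproducts (B : Type u) [Bicategory.{w, v} B] : Prop where
  exists_biinitial : ∃ Z : B, IsBiinitial Z
  exists_binary : ∀ U V : B, ∃ (D : B) (i : U ⟶ D) (j : V ⟶ D), IsBinaryBicoproduct i j

end bicoproducts

namespace Protocalibration
variable {C : Type u} [Bicategory.{w, v} C]

/-- `C` is `R`-extensive: it has finite bicoproducts, and the pseudofunctor `U ↦ RSlice R U`, acting on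
1-cells by bipullback, sends them to finite products of categories up to equivalence. -/
structure IsExtensive (R : Protocalibration C) : Prop where
  hasFiniteBicoproducts : HasFiniteBicoproducts C
  biinitial : ∀ {Z : C}, IsBiinitial Z → (Functor.star.{0} (RSlice R Z)).IsEquivalence
  binary : ∀ {U V D : C} {i : U ⟶ D} {j : V ⟶ D}, IsBinaryBicoproduct i j →
    ((RSlice.pullback R i).prod' (RSlice.pullback R j)).IsEquivalence

/-- `R`, as a wide locally full subbicategory, is closed under finite bicoproducts: the 1-cells out of
a bi-initial object and the coprojections are in `R`, and a 1-cell out of a binary bicoproduct is in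
`R` as soon as its composites with the two coprojections are. -/
structure ClosedUnderFiniteBicoproducts (R : Protocalibration C) : Prop where
  from_biinitial : ∀ {Z X : C} (h : Z ⟶ X), IsBiinitial Z → R.mem h
  coprojections : ∀ {U V D : C} {i : U ⟶ D} {j : V ⟶ D}, IsBinaryBicoproduct i j →
    R.mem i ∧ R.mem j
  copairing : ∀ {U V D W : C} {i : U ⟶ D} {j : V ⟶ D} (h : D ⟶ W), IsBinaryBicoproduct i j →
    R.mem (i ≫ h) → R.mem (j ≫ h) → R.mem h

end Protocalibration

end RSpn

/-! Everything rests on one fact about `C`, `RSlice.isBinaryBicoproduct_pb`. Let `i : U ⟶ D` and `j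
: V ⟶ D` be coprojections and `r : M ⟶ D` a 1-cell in `R`. Then the bipullback projections `i*M ⟶ M`
and `j*M ⟶ M` exhibit `M` as a bicoproduct. Since `i` and `j` lie in `R`, composing with them keeps
one inside `R`, and a morphism `i*M ⟶ i*M'` over `U` is the same as a morphism `i*M ⟶ M'` over `D`.
Full faithfulness in extensivity therefore says that `M` is the coproduct of `i*M` and `j*M` in the
category of `R`-objects over `D`. Any bicoproduct `E` of `i*M` and `j*M` in `C` is also such a
coproduct, its structure map to `D` being in `R` by closure under copairing. So the comparison `E ⟶
M` is invertible over `D`, hence an equivalence in `C`.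

(i) The coprojections in `Spn R` are the spans `(1, U, i)` and `(1, V, j)`; composing with them
pulls the left leg back along `i` and `j`. Transposing as above, now with right legs carried along,
and using that `M` is the bicoproduct of `i*M` and `j*M`, shows that a 2-cell out of a span on `M`
amounts to a pair of 2-cells between its restrictions. This is full faithfulness. For essential
surjectivity, extensivity supplies the left leg and the bicoproduct `M` supplies the right leg. In
the nullary case, an object with an `R`-map to a bi-initial object is itself bi-initial, so the
spans out of it form a contractible category.

(ii) The sum of two spans has as apex a bicoproduct `D` of the apices, with copaired legs `x` and
`y`. Existence and preservation come from one statement, `RSpan.isCoprod_inclusion`: for the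
coprojections `a`, `b` of `D`, the 2-cells `(xa, a) ⟶ (x, 1) ⟵ (xb, b)` become coproduct
coprojections after composition with any span `m` out of `D`. Indeed the new apices are `a*M`, `b*M`
and, up to equivalence, `M`. Taking `m = (1, y)` gives coproducts of arbitrary spans; taking `m =
(1, y)` followed by `t` gives their preservation. The initial span has bi-initial apex, a property
that composition with `t` keeps. -/

namespace RSpn

/-! ### Binary coproducts in a category, with explicit coprojections -/

section coproducts
variable {A : Type*} [Category A] {x y z : A}

/-- `f` and `g` are the coprojections of a binary coproduct. -/
def IsCoprod (f : x ⟶ z) (g : y ⟶ z) : Prop :=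
  ∀ ⦃q : A⦄ (f' : x ⟶ q) (g' : y ⟶ q), ∃! h : z ⟶ q, f ≫ h = f' ∧ g ≫ h = g'

namespace IsCoprod

theorem hom_ext {f : x ⟶ z} {g : y ⟶ z} (h : IsCoprod f g) {q : A} {a b : z ⟶ q}
    (h1 : f ≫ a = f ≫ b) (h2 : g ≫ a = g ≫ b) : a = b :=
  (h (f ≫ b) (g ≫ b)).unique ⟨h1, h2⟩ ⟨rfl, rfl⟩

theorem exists_desc {f : x ⟶ z} {g : y ⟶ z} (h : IsCoprod f g) {q : A} (f' : x ⟶ q)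
    (g' : y ⟶ q) : ∃ k : z ⟶ q, f ≫ k = f' ∧ g ≫ k = g' := (h f' g').exists

/-- Allows a coproduct to be computed after replacing all three objects; this is how factorised
spans and reassociated composites are handled later. -/
theorem iso_comp {f : x ⟶ z} {g : y ⟶ z} (h : IsCoprod f g) {x' y' z' : A} (a : x' ≅ x)
    (b : y' ≅ y) (c : z ≅ z') : IsCoprod (a.hom ≫ f ≫ c.hom) (b.hom ≫ g ≫ c.hom) := by
  intro q f' g'
  obtain ⟨k, h1, h2⟩ := h.exists_desc (a.inv ≫ f') (b.inv ≫ g')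
  refine ⟨c.inv ≫ k, ⟨by simp [h1], by simp [h2]⟩, ?_⟩
  rintro l ⟨rfl, rfl⟩
  rw [← cancel_epi c.hom, Iso.hom_inv_id_assoc]
  exact h.hom_ext (by simp [h1]) (by simp [h2])

theorem nonempty_isColimit {f : x ⟶ z} {g : y ⟶ z} (h : IsCoprod f g) :
    Nonempty (IsColimit (BinaryCofan.mk f g)) :=
  ⟨BinaryCofan.IsColimit.mk _ (fun a b => (h.exists_desc a b).choose)
    (fun a b => (h.exists_desc a b).choose_spec.1) (fun a b => (h.exists_desc a b).choose_spec.2)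
    (fun a b _ h1 h2 => h.hom_ext (h1.trans (h.exists_desc a b).choose_spec.1.symm)
      (h2.trans (h.exists_desc a b).choose_spec.2.symm))⟩

theorem hasBinaryCoproduct {f : x ⟶ z} {g : y ⟶ z} (h : IsCoprod f g) :
    HasBinaryCoproduct x y :=
  ⟨⟨⟨_, h.nonempty_isColimit.some⟩⟩⟩

theorem preservesColimit {f : x ⟶ z} {g : y ⟶ z} (h : IsCoprod f g) {A' : Type*} [Category A']
    (F : A ⥤ A') (h' : IsCoprod (F.map f) (F.map g)) : PreservesColimit (pair x y) F :=
  preservesColimit_of_preserves_colimit_cocone h.nonempty_isColimit.some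
    ((isColimitMapCoconeBinaryCofanEquiv F f g).symm h'.nonempty_isColimit.some)

end IsCoprod

end coproducts

/-! ### Bicoproducts, equivalences and bi-initial objects in a bicategory -/

section bicoproductLemmas
variable {B : Type u} [Bicategory.{w, v} B] {U V D W : B} {i : U ⟶ D} {j : V ⟶ D}

namespace IsBinaryBicoproduct

theorem exists_desc (h : IsBinaryBicoproduct i j) (f : U ⟶ W) (g : V ⟶ W) :
    ∃ k : D ⟶ W, Nonempty (i ≫ k ≅ f) ∧ Nonempty (j ≫ k ≅ g) := by
  have := h W
  let e := ((precomp W i).prod' (precomp W j)).objObjPreimageIso (f, g)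
  exact ⟨_, ⟨(CategoryTheory.Prod.fst _ _).mapIso e⟩, ⟨(CategoryTheory.Prod.snd _ _).mapIso e⟩⟩

theorem hom_ext (h : IsBinaryBicoproduct i j) {f g : D ⟶ W} {γ δ : f ⟶ g}
    (h1 : i ◁ γ = i ◁ δ) (h2 : j ◁ γ = j ◁ δ) : γ = δ := by
  have := h W
  exact ((precomp W i).prod' (precomp W j)).map_injective (Prod.ext h1 h2)

theorem exists_hom (h : IsBinaryBicoproduct i j) {f g : D ⟶ W} (γ : i ≫ f ⟶ i ≫ g)
    (δ : j ≫ f ⟶ j ≫ g) : ∃ ω : f ⟶ g, i ◁ ω = γ ∧ j ◁ ω = δ := by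
  have := h W
  obtain ⟨ω, hω⟩ := ((precomp W i).prod' (precomp W j)).map_surjective
    (X := f) (Y := g) (γ, δ)
  exact ⟨ω, congrArg Prod.fst hω, congrArg Prod.snd hω⟩

theorem exists_iso (h : IsBinaryBicoproduct i j) {f g : D ⟶ W} (γ : i ≫ f ≅ i ≫ g)
    (δ : j ≫ f ≅ j ≫ g) : ∃ ω : f ≅ g, i ◁ ω.hom = γ.hom ∧ j ◁ ω.hom = δ.hom := by
  obtain ⟨ω, h1, h2⟩ := h.exists_hom γ.hom δ.hom
  obtain ⟨ω', h1', h2'⟩ := h.exists_hom γ.inv δ.inv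
  exact ⟨⟨ω, ω', h.hom_ext (by simp [h1, h1']) (by simp [h2, h2']),
    h.hom_ext (by simp [h1, h1']) (by simp [h2, h2'])⟩, h1, h2⟩

end IsBinaryBicoproduct

/-- A 1-cell is an equivalence when it has an inverse up to invertible 2-cells. -/
def IsEquiv {X Y : B} (f : X ⟶ Y) : Prop :=
  ∃ g : Y ⟶ X, Nonempty (f ≫ g ≅ 𝟙 X) ∧ Nonempty (g ≫ f ≅ 𝟙 Y)

theorem IsEquiv.precomp {X Y : B} {f : X ⟶ Y} (hf : IsEquiv f) (W : B) :
    (precomp W f).IsEquivalence := by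
  obtain ⟨g, ⟨a⟩, ⟨b⟩⟩ := hf
  exact (CategoryTheory.Equivalence.mk (Bicategory.precomp W f) (Bicategory.precomp W g)
    (((precomposing _ _ W).mapIso b ≪≫ leftUnitorNatIso _ _).symm ≪≫ associatorNatIsoRight g f W)
    ((associatorNatIsoRight f g W).symm ≪≫
      ((precomposing _ _ W).mapIso a ≪≫ leftUnitorNatIso _ _))).isEquivalence_functor

theorem IsBinaryBicoproduct.of_iso (h : IsBinaryBicoproduct i j) {i' : U ⟶ D} {j' : V ⟶ D}
    (a : i ≅ i') (b : j ≅ j') : IsBinaryBicoproduct i' j' := fun W =>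
  have := h W
  Functor.isEquivalence_of_iso (NatIso.ofComponents
    (fun f => Iso.prod (whiskerRightIso a f) (whiskerRightIso b f))
    (fun _ => Prod.ext (whisker_exchange _ _) (whisker_exchange _ _)) :
      (Bicategory.precomp W i).prod' (Bicategory.precomp W j) ≅
        (Bicategory.precomp W i').prod' (Bicategory.precomp W j'))

theorem IsBinaryBicoproduct.comp_equiv (h : IsBinaryBicoproduct i j) {E : B} {k : D ⟶ E}
    (hk : IsEquiv k) : IsBinaryBicoproduct (i ≫ k) (j ≫ k) := fun W =>
  have := h W
  have := hk.precomp W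
  Functor.isEquivalence_of_iso (NatIso.ofComponents
    (fun f => Iso.prod (α_ i k f).symm (α_ j k f).symm)
    (fun η => Prod.ext
      (show i ◁ k ◁ η ≫ (α_ i k _).inv = (α_ i k _).inv ≫ (i ≫ k) ◁ η by simp)
      (show j ◁ k ◁ η ≫ (α_ j k _).inv = (α_ j k _).inv ≫ (j ≫ k) ◁ η by simp)) :
      Bicategory.precomp W k ⋙ (Bicategory.precomp W i).prod' (Bicategory.precomp W j) ≅
        (Bicategory.precomp W (i ≫ k)).prod' (Bicategory.precomp W (j ≫ k)))

/-- Elementary form of contractibility, used both for bi-initial objects and for the nullary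
extensivity condition. -/
theorem isEquivalence_star_iff {A : Type*} [Category A] :
    (Functor.star.{0} A).IsEquivalence ↔
      Nonempty A ∧ ∀ x y : A, Nonempty (Unique (x ⟶ y)) := by
  constructor
  · intro h
    refine ⟨⟨(Functor.star.{0} A).objPreimage ⟨⟨⟩⟩⟩, fun x y => ?_⟩
    exact ⟨⟨⟨(Functor.star.{0} A).preimage (eqToHom rfl)⟩,
      fun f => (Functor.star.{0} A).map_injective (Subsingleton.elim _ _)⟩⟩
  · rintro ⟨⟨a⟩, h⟩
    exact
      { faithful := ⟨fun {x y} f g _ => by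
          obtain ⟨u⟩ := h x y
          exact Subsingleton.elim f g⟩
        full := ⟨fun {x y} f => by
          obtain ⟨u⟩ := h x y
          exact ⟨u.default, Subsingleton.elim _ _⟩⟩
        essSurj := ⟨fun y => ⟨a, ⟨eqToIso (by cases y; rfl)⟩⟩⟩ }

namespace IsBiinitial

theorem nonempty (h : IsBiinitial U) (W : B) : Nonempty (U ⟶ W) :=
  (isEquivalence_star_iff.1 (h W)).1

theorem hom_ext (h : IsBiinitial U) {f g : U ⟶ W} (γ δ : f ⟶ g) : γ = δ := by
  obtain ⟨u⟩ := (isEquivalence_star_iff.1 (h W)).2 f g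
  exact Subsingleton.elim γ δ

theorem nonempty_hom (h : IsBiinitial U) (f g : U ⟶ W) : Nonempty (f ⟶ g) := by
  obtain ⟨u⟩ := (isEquivalence_star_iff.1 (h W)).2 f g
  exact ⟨u.default⟩

theorem nonempty_iso (h : IsBiinitial U) (f g : U ⟶ W) : Nonempty (f ≅ g) := by
  obtain ⟨a⟩ := h.nonempty_hom f g
  obtain ⟨b⟩ := h.nonempty_hom g f
  exact ⟨⟨a, b, h.hom_ext _ _, h.hom_ext _ _⟩⟩

theorem of_isEquiv (h : IsBiinitial U) {k : V ⟶ U} (hk : IsEquiv k) : IsBiinitial V := by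
  obtain ⟨k', ⟨a⟩, ⟨b⟩⟩ := hk
  intro W
  rw [isEquivalence_star_iff]
  have := IsEquiv.precomp (f := k') ⟨k, ⟨b⟩, ⟨a⟩⟩ W
  obtain ⟨f⟩ := h.nonempty W
  refine ⟨⟨k ≫ f⟩, fun x y => ?_⟩
  obtain ⟨c⟩ := h.nonempty_hom (k' ≫ x) (k' ≫ y)
  exact ⟨⟨⟨(Bicategory.precomp W k').preimage c⟩, fun d =>
    (Bicategory.precomp W k').map_injective (h.hom_ext _ _)⟩⟩

end IsBiinitial

end bicoproductLemmas

/-! ### `R`-objects over a base: extensivity turns bipullbacks into bicoproducts -/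

namespace RSlice
variable {C : Type u} [Bicategory.{w, v} C] {R : Protocalibration C} {U V D : C}

/-- The morphism represented by `m`. -/
def PreHom.cls {s t : RSlice R U} (m : PreHom s t) : s ⟶ t := _root_.Quotient.mk _ m

theorem PreHom.cls_comp {s t r : RSlice R U} (m : PreHom s t) (n : PreHom t r) :
    (m.comp n).cls = m.cls ≫ n.cls := rfl

theorem PreHom.cls_id (s : RSlice R U) : (PreHom.id s).cls = 𝟙 s := rfl

theorem PreHom.cls_eq_iff {s t : RSlice R U} {m n : PreHom s t} : m.cls = n.cls ↔ Rel m n :=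
  ⟨_root_.Quotient.exact, fun h => _root_.Quotient.sound h⟩

theorem exists_cls {s t : RSlice R U} (f : s ⟶ t) : ∃ m : PreHom s t, m.cls = f :=
  _root_.Quotient.exists_rep f

theorem isEquiv_of_inverse {s t : RSlice R U} {m : PreHom s t} {f : t ⟶ s}
    (h1 : m.cls ≫ f = 𝟙 s) (h2 : f ≫ m.cls = 𝟙 t) : IsEquiv m.f := by
  obtain ⟨n, rfl⟩ := exists_cls f
  rw [← PreHom.cls_comp, ← PreHom.cls_id, PreHom.cls_eq_iff] at h1 h2
  obtain ⟨γ, -⟩ := h1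
  obtain ⟨δ, -⟩ := h2
  exact ⟨n.f, ⟨γ⟩, ⟨δ⟩⟩

theorem isEquiv_of_iso {s t : RSlice R U} (e : s ≅ t) :
    ∃ m : PreHom s t, m.cls = e.hom ∧ IsEquiv m.f := by
  obtain ⟨m, hm⟩ := exists_cls e.hom
  exact ⟨m, hm, isEquiv_of_inverse (f := e.inv) (by simp [hm]) (by simp [hm])⟩

/-- The category of `R`-objects over `U` is contractible, so `s` is isomorphic there to the identity
of `U`; an isomorphism of `R`-objects has an equivalence underneath. -/
theorem isBiinitial_dom (hE : R.IsExtensive) (hU : IsBiinitial U) (s : RSlice R U) :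
    IsBiinitial s.dom := by
  obtain ⟨-, h⟩ := isEquivalence_star_iff.1 (hE.biinitial hU)
  let t : RSlice R U := ⟨U, 𝟙 U, R.mem_id U⟩
  obtain ⟨a⟩ := h s t
  obtain ⟨b⟩ := h t s
  obtain ⟨c⟩ := h s s
  obtain ⟨d⟩ := h t t
  obtain ⟨m, -, hm⟩ := isEquiv_of_iso
    (⟨a.default, b.default, Subsingleton.elim _ _, Subsingleton.elim _ _⟩ : s ≅ t)
  exact hU.of_isEquiv hm

/-- Two morphisms over `U` whose underlying 1-cells form a bicoproduct are the coprojections of a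
coproduct. -/
theorem isCoprod_of_isBinaryBicoproduct {s s' t : RSlice R U} (m : PreHom s t)
    (m' : PreHom s' t) (h : IsBinaryBicoproduct m.f m'.f) : IsCoprod m.cls m'.cls := by
  intro r f f'
  obtain ⟨n, rfl⟩ := exists_cls f
  obtain ⟨n', rfl⟩ := exists_cls f'
  obtain ⟨k, ⟨a⟩, ⟨a'⟩⟩ := h.exists_desc n.f n'.f
  -- The two triangles force the restriction of `φ` to each summand; the bicoproduct glues these
  -- values.
  obtain ⟨φ, h1, h2⟩ := h.exists_iso (f := k ≫ r.hom) (g := t.hom)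
    ((α_ _ _ _).symm ≪≫ whiskerRightIso a _ ≪≫ n.φ ≪≫ m.φ.symm)
    ((α_ _ _ _).symm ≪≫ whiskerRightIso a' _ ≪≫ n'.φ ≪≫ m'.φ.symm)
  refine ⟨PreHom.cls ⟨k, φ⟩, ⟨?_, ?_⟩, ?_⟩
  · rw [← PreHom.cls_comp, PreHom.cls_eq_iff]
    exact ⟨a, by simp [h1]⟩
  · rw [← PreHom.cls_comp, PreHom.cls_eq_iff]
    exact ⟨a', by simp [h2]⟩
  · rintro g ⟨e, e'⟩
    obtain ⟨l, rfl⟩ := exists_cls g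
    rw [← PreHom.cls_comp, PreHom.cls_eq_iff] at e e'
    obtain ⟨γ, hγ⟩ := e
    obtain ⟨γ', hγ'⟩ := e'
    -- A competitor `l` agrees with `k` on each summand up to isomorphism, and these isomorphisms
    -- glue. Compatibility with the maps to `U` may then be tested on summands.
    obtain ⟨δ, d1, d2⟩ := h.exists_iso (f := l.f) (g := k) (γ ≪≫ a.symm) (γ' ≪≫ a'.symm)
    rw [PreHom.cls_eq_iff]
    refine ⟨δ, h.hom_ext ?_ ?_⟩
    · rw [whiskerLeft_comp, h1, ← cancel_epi (α_ _ _ _).hom, ← cancel_mono m.φ.hom]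
      simp at hγ
      simp [reassoc_of% whisker_assoc_symm, d1, hγ]
    · rw [whiskerLeft_comp, h2, ← cancel_epi (α_ _ _ _).hom, ← cancel_mono m'.φ.hom]
      simp at hγ'
      simp [reassoc_of% whisker_assoc_symm, d2, hγ']

/-- Composition with a 1-cell in `R`, on objects. -/
abbrev push (i : U ⟶ D) (hi : R.mem i) (s : RSlice R U) : RSlice R D where
  dom := s.dom
  hom := s.hom ≫ i
  hom_mem := R.mem_comp s.hom_mem hi

/-- The projection of a bipullback along `i`, as a morphism over the codomain of `i`. -/
noncomputable abbrev counit (i : U ⟶ D) (hi : R.mem i) (r : RSlice R D) :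
    PreHom (push i hi (pullbackObj i r)) r where
  f := (pb i r).fst
  φ := (pb i r).iso

/-- The transpose of a morphism into a bipullback along `i`. -/
noncomputable abbrev transpose (i : U ⟶ D) (hi : R.mem i) {r r' : RSlice R D}
    (k : PreHom (pullbackObj i r) (pullbackObj i r')) :
    PreHom (push i hi (pullbackObj i r)) r' where
  f := k.f ≫ (pb i r').fst
  φ := (pb i r').fill k.f ≪≫ whiskerRightIso k.φ i

theorem transpose_rel {i : U ⟶ D} (hi : R.mem i) {r r' : RSlice R D}
    {k k' : PreHom (pullbackObj i r) (pullbackObj i r')} (h : PreHom.Rel k k') :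
    PreHom.Rel (transpose i hi k) (transpose i hi k') := by
  obtain ⟨γ, hγ⟩ := h
  refine ⟨whiskerRightIso γ _, ?_⟩
  have := (pb i r').fill_naturality γ.hom
  simpa [← hγ] using this =≫ (k'.φ.hom ▷ i)

/-- One-dimensional universal property of the bipullback: `n` with its 2-cell is a square over
`r'.hom` and `i`. -/
theorem exists_transpose {i : U ⟶ D} (hi : R.mem i) {r r' : RSlice R D}
    (n : PreHom (push i hi (pullbackObj i r)) r') : ∃ k, (transpose i hi k).cls = n.cls := by
  obtain ⟨h, a, b, e⟩ := (R.pullback_isBipullback r'.hom r'.hom_mem i).exists_lift n.f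
    (pullbackObj i r).hom n.φ
  refine ⟨⟨h, b⟩, PreHom.cls_eq_iff.2 ⟨a, ?_⟩⟩
  simpa using e

/-- Bipullback along `i` behaves as a right adjoint to composition with `i`: the equation defining
the pulled-back morphism is, read backwards, the equation saying that its transpose is `m`
restricted along the counit. -/
theorem pullback_map_cls_eq_iff {i : U ⟶ D} (hi : R.mem i) {r r' : RSlice R D} (m : PreHom r r')
    (k : PreHom (pullbackObj i r) (pullbackObj i r')) :
    (pullback R i).map m.cls = k.cls ↔ (counit i hi r).cls ≫ m.cls = (transpose i hi k).cls := by
  have key : ∀ l : PreHom (pullbackObj i r) (pullbackObj i r'),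
      m.IsPullback i l ↔ (counit i hi r).cls ≫ m.cls = (transpose i hi l).cls := fun l => by
    rw [eq_comm, ← PreHom.cls_comp, PreHom.cls_eq_iff]
    constructor
    · rintro ⟨γ, hγ⟩
      exact ⟨γ, by simpa using hγ.symm⟩
    · rintro ⟨γ, hγ⟩
      exact ⟨γ, by simpa using hγ.symm⟩
  rw [← key]
  constructor
  · intro h
    obtain ⟨l, hl⟩ := m.exists_isPullback i
    rw [key] at hl ⊢
    rw [hl]
    have : l.cls = k.cls := by
      rw [← h]
      exact (pullbackMap_mk ((key l).2 hl)).symm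
    exact PreHom.cls_eq_iff.2 (transpose_rel hi (PreHom.cls_eq_iff.1 this))
  · exact fun h => pullbackMap_mk h

section
variable {i : U ⟶ D} {j : V ⟶ D}

/-- By transposition, a pair of morphisms out of the two restrictions of `r` is a morphism between
images under the joint bipullback functor. Full faithfulness of that functor gives exactly one
morphism out of `r` inducing it. -/
theorem isCoprod_counit (hi : R.mem i) (hj : R.mem j)
    (h : ((pullback R i).prod' (pullback R j)).IsEquivalence) (r : RSlice R D) :
    IsCoprod (counit i hi r).cls (counit j hj r).cls := by
  intro r' f g
  obtain ⟨f, rfl⟩ := exists_cls f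
  obtain ⟨g, rfl⟩ := exists_cls g
  obtain ⟨a, ha⟩ := exists_transpose hi f
  obtain ⟨b, hb⟩ := exists_transpose hj g
  have key : ∀ k : r ⟶ r', ((counit i hi r).cls ≫ k = f.cls ∧ (counit j hj r).cls ≫ k = g.cls) ↔
      ((pullback R i).prod' (pullback R j)).map k = (a.cls, b.cls) := fun k => by
    obtain ⟨k, rfl⟩ := exists_cls k
    rw [← ha, ← hb, ← pullback_map_cls_eq_iff, ← pullback_map_cls_eq_iff]
    exact ⟨fun h => Prod.ext h.1 h.2, fun h => ⟨congrArg Prod.fst h, congrArg Prod.snd h⟩⟩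
  obtain ⟨k, hk⟩ := ((pullback R i).prod' (pullback R j)).map_surjective
    (X := r) (Y := r') (a.cls, b.cls)
  refine ⟨k, (key k).2 hk, fun l hl => ?_⟩
  exact ((pullback R i).prod' (pullback R j)).map_injective (((key l).1 hl).trans hk.symm)

/-- In an extensive bicategory, the bipullbacks of a 1-cell in `R` along the coprojections of a
bicoproduct form a bicoproduct. -/
theorem isBinaryBicoproduct_pb (hE : R.IsExtensive) (hR : R.ClosedUnderFiniteBicoproducts)
    (h : IsBinaryBicoproduct i j) (r : RSlice R D) :
    IsBinaryBicoproduct (pb i r).fst (pb j r).fst := by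
  obtain ⟨hi, hj⟩ := hR.coprojections h
  -- Compare `r` with an actual bicoproduct `E` of the two bipullbacks through the copairing `k` of
  -- the projections.
  obtain ⟨E, a, b, hE'⟩ := hE.hasFiniteBicoproducts.exists_binary (pb i r).pt (pb j r).pt
  obtain ⟨k, ⟨ka⟩, ⟨kb⟩⟩ := hE'.exists_desc (pb i r).fst (pb j r).fst
  let ea : a ≫ k ≫ r.hom ≅ (push i hi (pullbackObj i r)).hom :=
    (α_ _ _ _).symm ≪≫ whiskerRightIso ka _ ≪≫ (pb i r).iso
  let eb : b ≫ k ≫ r.hom ≅ (push j hj (pullbackObj j r)).hom :=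
    (α_ _ _ _).symm ≪≫ whiskerRightIso kb _ ≪≫ (pb j r).iso
  -- On each summand the structure map of `E` is a bipullback leg followed by a coprojection, both
  -- in `R`; closure under copairing then makes `E` an `R`-object over `D`.
  let r' : RSlice R D := ⟨E, k ≫ r.hom, hR.copairing _ hE'
    (R.mem_of_iso ea.symm (push i hi (pullbackObj i r)).hom_mem)
    (R.mem_of_iso eb.symm (push j hj (pullbackObj j r)).hom_mem)⟩
  let A : PreHom (push i hi (pullbackObj i r)) r' := ⟨a, ea⟩
  let B : PreHom (push j hj (pullbackObj j r)) r' := ⟨b, eb⟩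
  let K : PreHom r' r := ⟨k, Iso.refl _⟩
  have hA : A.cls ≫ K.cls = (counit i hi r).cls := by
    rw [← PreHom.cls_comp, PreHom.cls_eq_iff]
    exact ⟨ka, by simp [A, K, ea]⟩
  have hB : B.cls ≫ K.cls = (counit j hj r).cls := by
    rw [← PreHom.cls_comp, PreHom.cls_eq_iff]
    exact ⟨kb, by simp [B, K, eb]⟩
  have hc := isCoprod_counit hi hj (hE.binary h) r
  obtain ⟨l, l1, l2⟩ := hc.exists_desc A.cls B.cls
  -- Both `r'` and `r` are coproducts of the same two objects over `D`, and `K` respects the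
  -- coprojections. So `K` is invertible over `D`, and `k` is an equivalence.
  have hk : IsEquiv K.f := isEquiv_of_inverse (f := l)
    ((isCoprod_of_isBinaryBicoproduct A B hE').hom_ext
      (by rw [reassoc_of% hA, l1, Category.comp_id])
      (by rw [reassoc_of% hB, l2, Category.comp_id]))
    (hc.hom_ext (by rw [reassoc_of% l1, hA, Category.comp_id])
      (by rw [reassoc_of% l2, hB, Category.comp_id]))
  exact (hE'.comp_equiv hk).of_iso ka kb

end

end RSlice

/-! ### Isomorphisms, coproducts and initial objects in categories of spans -/

namespace SpanDiagram
variable {C : Type u} [Bicategory.{w, v} C] {X Y : C}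

/-- The 2-cell of spans represented by `m`. -/
def PreHom.cls {s t : SpanDiagram X Y} (m : PreHom s t) : s ⟶ t := _root_.Quotient.mk _ m

theorem PreHom.cls_comp {s t r : SpanDiagram X Y} (m : PreHom s t) (n : PreHom t r) :
    (m.comp n).cls = m.cls ≫ n.cls := rfl

theorem PreHom.cls_id (s : SpanDiagram X Y) : (PreHom.id s).cls = 𝟙 s := rfl

theorem PreHom.cls_eq_iff {s t : SpanDiagram X Y} {m n : PreHom s t} : m.cls = n.cls ↔ Rel m n :=
  ⟨_root_.Quotient.exact, fun h => _root_.Quotient.sound h⟩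

theorem exists_cls {s t : SpanDiagram X Y} (f : s ⟶ t) : ∃ m : PreHom s t, m.cls = f :=
  _root_.Quotient.exists_rep f

theorem isEquiv_of_inverse {s t : SpanDiagram X Y} {m : PreHom s t} {f : t ⟶ s}
    (h1 : m.cls ≫ f = 𝟙 s) (h2 : f ≫ m.cls = 𝟙 t) : IsEquiv m.f := by
  obtain ⟨n, rfl⟩ := exists_cls f
  rw [← PreHom.cls_comp, ← PreHom.cls_id, PreHom.cls_eq_iff] at h1 h2
  obtain ⟨γ, -⟩ := h1
  obtain ⟨δ, -⟩ := h2
  exact ⟨n.f, ⟨γ⟩, ⟨δ⟩⟩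

/-- Precomposition with the equivalence `m.f` is fully faithful, so `φ` and `σ` over the inverse
1-cell can be chosen by prescribing their whiskerings. The prescription is exactly what makes `γ` an
isomorphism of representatives. -/
theorem PreHom.exists_right_inverse {s t : SpanDiagram X Y} (m : PreHom s t) (hm : IsEquiv m.f)
    [IsIso m.σ] : ∃ n : PreHom t s, m.cls ≫ n.cls = 𝟙 s ∧ IsEquiv n.f ∧ IsIso n.σ := by
  have := hm.precomp X
  have := hm.precomp Y
  obtain ⟨g, ⟨γ⟩, ⟨δ⟩⟩ := hm
  obtain ⟨φ, hφ⟩ : ∃ φ : g ≫ s.left ≅ t.left, m.f ◁ φ.hom =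
      ((α_ m.f g s.left).symm ≪≫ whiskerRightIso γ s.left ≪≫ λ_ _ ≪≫ m.φ.symm).hom :=
    ⟨(precomp X m.f).preimageIso
      ((α_ m.f g s.left).symm ≪≫ whiskerRightIso γ s.left ≪≫ λ_ _ ≪≫ m.φ.symm),
      (precomp X m.f).map_preimage _⟩
  obtain ⟨σ, hσ⟩ : ∃ σ : t.right ≅ g ≫ s.right, m.f ◁ σ.hom =
      ((asIso m.σ).symm ≪≫ (λ_ _).symm ≪≫ whiskerRightIso γ.symm s.right ≪≫ α_ _ _ _).hom :=
    ⟨(precomp Y m.f).preimageIso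
      ((asIso m.σ).symm ≪≫ (λ_ _).symm ≪≫ whiskerRightIso γ.symm s.right ≪≫ α_ _ _ _),
      (precomp Y m.f).map_preimage _⟩
  refine ⟨⟨g, φ, σ.hom⟩, ?_, ⟨m.f, ⟨δ⟩, ⟨γ⟩⟩, inferInstance⟩
  rw [← PreHom.cls_comp, ← PreHom.cls_id, PreHom.cls_eq_iff]
  exact ⟨γ, by simp [hφ], by simp [hσ]⟩

/-- The right inverse again satisfies the hypotheses, so it has a right inverse of its own, which
must be `m`. This avoids choosing an adjoint equivalence. -/
theorem PreHom.isIso_cls {s t : SpanDiagram X Y} (m : PreHom s t) (hm : IsEquiv m.f)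
    [IsIso m.σ] : IsIso m.cls := by
  obtain ⟨n, h1, hn, hσ⟩ := m.exists_right_inverse hm
  obtain ⟨l, h2, -, -⟩ := n.exists_right_inverse hn
  have : m.cls = l.cls := by
    rw [← Category.comp_id m.cls, ← h2, reassoc_of% h1]
  exact ⟨n.cls, h1, by rw [this, h2]⟩

/-- Two 2-cells of spans with invertible right components whose 1-cells between apices form a
bicoproduct are the coprojections of a coproduct. -/
theorem isCoprod_of_isBinaryBicoproduct {s s' t : SpanDiagram X Y} (m : PreHom s t)
    (m' : PreHom s' t) (h : IsBinaryBicoproduct m.f m'.f) [IsIso m.σ] [IsIso m'.σ] :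
    IsCoprod m.cls m'.cls := by
  intro r f f'
  obtain ⟨n, rfl⟩ := exists_cls f
  obtain ⟨n', rfl⟩ := exists_cls f'
  obtain ⟨k, ⟨a⟩, ⟨a'⟩⟩ := h.exists_desc n.f n'.f
  obtain ⟨φ, h1, h2⟩ := h.exists_iso (f := k ≫ r.left) (g := t.left)
    ((α_ _ _ _).symm ≪≫ whiskerRightIso a _ ≪≫ n.φ ≪≫ m.φ.symm)
    ((α_ _ _ _).symm ≪≫ whiskerRightIso a' _ ≪≫ n'.φ ≪≫ m'.φ.symm)
  -- Here invertibility of `m.σ` and `m'.σ` matters: it determines `σ` on each summand.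
  obtain ⟨σ, h3, h4⟩ := h.exists_hom (f := t.right) (g := k ≫ r.right)
    (inv m.σ ≫ n.σ ≫ a.inv ▷ _ ≫ (α_ _ _ _).hom)
    (inv m'.σ ≫ n'.σ ≫ a'.inv ▷ _ ≫ (α_ _ _ _).hom)
  refine ⟨PreHom.cls ⟨k, φ, σ⟩, ⟨?_, ?_⟩, ?_⟩
  · rw [← PreHom.cls_comp, PreHom.cls_eq_iff]
    exact ⟨a, by simp [h1], by simp [h3]⟩
  · rw [← PreHom.cls_comp, PreHom.cls_eq_iff]
    exact ⟨a', by simp [h2], by simp [h4]⟩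
  · rintro g ⟨e, e'⟩
    obtain ⟨l, rfl⟩ := exists_cls g
    rw [← PreHom.cls_comp, PreHom.cls_eq_iff] at e e'
    obtain ⟨γ, hγ, hγσ⟩ := e
    obtain ⟨γ', hγ', hγσ'⟩ := e'
    obtain ⟨δ, d1, d2⟩ := h.exists_iso (f := l.f) (g := k) (γ ≪≫ a.symm) (γ' ≪≫ a'.symm)
    rw [PreHom.cls_eq_iff]
    refine ⟨δ, h.hom_ext ?_ ?_, h.hom_ext ?_ ?_⟩
    · rw [whiskerLeft_comp, h1, ← cancel_epi (α_ _ _ _).hom, ← cancel_mono m.φ.hom]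
      simp at hγ
      simp [reassoc_of% whisker_assoc_symm, d1, hγ]
    · rw [whiskerLeft_comp, h2, ← cancel_epi (α_ _ _ _).hom, ← cancel_mono m'.φ.hom]
      simp at hγ'
      simp [reassoc_of% whisker_assoc_symm, d2, hγ']
    · rw [whiskerLeft_comp, h3, ← cancel_epi m.σ, ← cancel_mono (α_ _ _ _).inv]
      simp at hγσ
      simp [whisker_assoc_symm, d1, reassoc_of% hγσ]
    · rw [whiskerLeft_comp, h4, ← cancel_epi m'.σ, ← cancel_mono (α_ _ _ _).inv]
      simp at hγσ'
      simp [whisker_assoc_symm, d2, reassoc_of% hγσ']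

theorem nonempty_unique_of_isBiinitial {s : SpanDiagram X Y} (h : IsBiinitial s.apex)
    (t : SpanDiagram X Y) : Nonempty (Unique (s ⟶ t)) := by
  obtain ⟨f⟩ := h.nonempty t.apex
  obtain ⟨φ⟩ := h.nonempty_iso (f ≫ t.left) s.left
  obtain ⟨σ⟩ := h.nonempty_hom s.right (f ≫ t.right)
  refine ⟨⟨⟨PreHom.cls ⟨f, φ, σ⟩⟩, fun g => ?_⟩⟩
  obtain ⟨l, rfl⟩ := exists_cls g
  obtain ⟨γ⟩ := h.nonempty_iso l.f f
  exact PreHom.cls_eq_iff.2 ⟨γ, h.hom_ext _ _, h.hom_ext _ _⟩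

end SpanDiagram

/-! ### Composites with a sum of spans -/

namespace RSpan
variable {C : Type u} [Bicategory.{w, v} C] {R : Protocalibration C} {X Y Z W U V D : C}

open SpanDiagram

/-- The 2-cell of `R`-spans represented by `m`. -/
def cls {s t : R.RSpan X Y} (m : PreHom s.toSpanDiagram t.toSpanDiagram) : s ⟶ t := m.cls

theorem isIso_cls {s t : R.RSpan X Y} (m : PreHom s.toSpanDiagram t.toSpanDiagram)
    (hm : IsEquiv m.f) [IsIso m.σ] : IsIso (cls m) := by
  obtain ⟨n, h1, h2⟩ := m.isIso_cls hm
  exact ⟨n, h1, h2⟩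

theorem isCoprod_cls {s s' t : R.RSpan X Y} (m : PreHom s.toSpanDiagram t.toSpanDiagram)
    (m' : PreHom s'.toSpanDiagram t.toSpanDiagram) (h : IsBinaryBicoproduct m.f m'.f)
    [IsIso m.σ] [IsIso m'.σ] : IsCoprod (cls m) (cls m') := fun r f f' =>
  SpanDiagram.isCoprod_of_isBinaryBicoproduct m m' h (q := r.toSpanDiagram) f f'

/-- This projection is the 1-cell underlying the left unitor, an invertible 2-cell of spans. -/
theorem isEquiv_pb_fst_id (m : R.RSpan X Y) : IsEquiv (pb (id R X) m).fst :=
  SpanDiagram.isEquiv_of_inverse (m := leftPre m) (f := leftInv m) (left_hom_inv m) (left_inv_hom m)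

theorem isEquiv_pb_snd_id (m : R.RSpan X Y) : IsEquiv (pb m (id R Y)).snd :=
  SpanDiagram.isEquiv_of_inverse (m := rightPre m) (f := rightInv m) (right_hom_inv m)
    (right_inv_hom m)

/-- When the right components are invertible, the square to be lifted is invertible. A groupoid
opfibration reflects isomorphisms, so the lifting `η` is invertible too, and the composite is an
ordinary map of bipullbacks. -/
theorem exists_rep_hc {s s' : R.RSpan X Y} {t t' : R.RSpan Y Z}
    (m : PreHom s.toSpanDiagram s'.toSpanDiagram) (n : PreHom t.toSpanDiagram t'.toSpanDiagram)
    [IsIso m.σ] [IsIso n.σ] :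
    ∃ k : PreHom (comp s t).toSpanDiagram (comp s' t').toSpanDiagram,
      cls k = hc (cls m) (cls n) ∧ IsIso k.σ ∧
        Nonempty (k.f ≫ (pb s' t').fst ≅ (pb s t).fst ≫ n.f) := by
  obtain ⟨k, ⟨ξ, η, hd⟩, e⟩ := lifts_hcomp m n
  have : IsIso η := Protocalibration.isIso_of_isLift (pb s' t') (R.opfib t'.left_mem) (a := ξ)
    (θ := ((unitCone s t).post m n).θ) hd.hθ
  refine ⟨k, e, ?_, ⟨(asIso η).symm⟩⟩
  rw [σ_eq_of_isHom hd]
  infer_instance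

/-- The span `(x, D, 1)`. -/
abbrev ofLeft (x : D ⟶ X) (hx : R.mem x) : R.RSpan X D := ⟨⟨D, x, 𝟙 D⟩, hx⟩

/-- The span `(1, U, i)`. -/
abbrev ofRight (R : Protocalibration C) (i : U ⟶ D) : R.RSpan U D := ⟨⟨U, 𝟙 U, i⟩, R.mem_id U⟩

/-- The 2-cell from `(a ≫ x, A, a)` to `(x, D, 1)` given by `a`. -/
abbrev inclusion (a : U ⟶ D) (x : D ⟶ X) :
    PreHom (⟨U, a ≫ x, a⟩ : SpanDiagram X D) ⟨D, x, 𝟙 D⟩ where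
  f := a
  φ := Iso.refl _
  σ := (ρ_ a).inv

/-- The apices of the composites are the bipullbacks of `m.left` along `a`, `b` and `𝟙 D`. The first
two have bicoproduct `m.apex`, which is equivalent to the third; a bicoproduct on apices gives a
coproduct of spans. -/
theorem isCoprod_inclusion (hE : R.IsExtensive) (hR : R.ClosedUnderFiniteBicoproducts)
    {a : U ⟶ D} {b : V ⟶ D} (h : IsBinaryBicoproduct a b) (x : D ⟶ X) (hx : R.mem x)
    (ha : R.mem (a ≫ x)) (hb : R.mem (b ≫ x)) (m : R.RSpan D Z) :
    IsCoprod
      (hc (cls (s := ⟨⟨U, a ≫ x, a⟩, ha⟩) (t := ofLeft x hx) (inclusion a x)) (𝟙 m))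
      (hc (cls (s := ⟨⟨V, b ≫ x, b⟩, hb⟩) (t := ofLeft x hx) (inclusion b x)) (𝟙 m)) := by
  obtain ⟨k, hk, hkσ, ⟨e⟩⟩ := exists_rep_hc (s := ⟨⟨U, a ≫ x, a⟩, ha⟩) (s' := ofLeft x hx)
    (inclusion a x) (PreHom.id m.toSpanDiagram)
  obtain ⟨l, hl, hlσ, ⟨e'⟩⟩ := exists_rep_hc (s := ⟨⟨V, b ≫ x, b⟩, hb⟩) (s' := ofLeft x hx)
    (inclusion b x) (PreHom.id m.toSpanDiagram)
  have hP := RSlice.isBinaryBicoproduct_pb hE hR h ⟨m.apex, m.left, m.left_mem⟩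
  obtain ⟨g, ⟨c⟩, ⟨d⟩⟩ := isEquiv_pb_fst_id m
  -- `g` is inverse to the projection from the bipullback along `𝟙 D`. Since `k.f` and `l.f`
  -- followed by that projection are the two projections of `hP`, they are these projections
  -- followed by `g`.
  have hQ := (hP.comp_equiv (k := g) ⟨_, ⟨d⟩, ⟨c⟩⟩).of_iso
    (whiskerRightIso (e ≪≫ ρ_ _).symm g ≪≫ α_ _ _ _ ≪≫ whiskerLeftIso k.f c ≪≫ ρ_ _)
    (whiskerRightIso (e' ≪≫ ρ_ _).symm g ≪≫ α_ _ _ _ ≪≫ whiskerLeftIso l.f c ≪≫ ρ_ _)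
  have := isCoprod_cls k l hQ
  rw [hk, hl] at this
  exact this

/-- A span whose right leg factors as `a ≫ y` is a composite with `(1, D, y)`, because bipullback
along an identity changes nothing. This puts an arbitrary span in the form needed by
`isCoprod_inclusion`. -/
theorem nonempty_iso_comp_ofRight (s : R.RSpan X Y) {x : D ⟶ X} {y : D ⟶ Y} {a : s.apex ⟶ D}
    (ha : R.mem (a ≫ x)) (e : a ≫ x ≅ s.left) (e' : a ≫ y ≅ s.right) :
    Nonempty (s ≅ comp ⟨⟨s.apex, a ≫ x, a⟩, ha⟩ (ofRight R y)) := by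
  let q : R.RSpan X D := ⟨⟨s.apex, a ≫ x, a⟩, ha⟩
  let k : PreHom (comp q (ofRight R y)).toSpanDiagram s.toSpanDiagram :=
    { f := (pb q (id R D)).snd
      φ := whiskerLeftIso _ e.symm
      σ := (whiskerRightIso ((ρ_ _).symm ≪≫ (pb q (id R D)).iso) y ≪≫ α_ _ _ _ ≪≫
        whiskerLeftIso _ e').hom }
  have : IsIso k.σ := Iso.isIso_hom _
  have : IsIso (cls k) := isIso_cls k (isEquiv_pb_snd_id q)
  exact ⟨(asIso (cls k)).symm⟩

end RSpan

/-! ### Restriction of spans along coprojections -/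

namespace RSpan
variable {C : Type u} [Bicategory.{w, v} C] {R : Protocalibration C} {X Y Z W U V D : C}

open SpanDiagram

/-- Precomposition with a 1-cell in `R`, regarded as a span in the reverse direction. -/
abbrev push (i : U ⟶ D) (hi : R.mem i) (s : R.RSpan U W) : R.RSpan D W where
  apex := s.apex
  left := s.left ≫ i
  right := s.right
  left_mem := R.mem_comp s.left_mem hi

/-- The span obtained from `m` by bipullback of its left leg along `i`. -/
noncomputable abbrev pullbackLeft (i : U ⟶ D) (m : R.RSpan D W) : R.RSpan U W where
  apex := (pb (ofRight R i) m).pt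
  left := (pb (ofRight R i) m).snd
  right := (pb (ofRight R i) m).fst ≫ m.right
  left_mem := R.pullback_snd_mem _ _ _

/-- The projection of a bipullback along `i`, as a 2-cell of spans. -/
noncomputable abbrev counit (i : U ⟶ D) (hi : R.mem i) (m : R.RSpan D W) :
    PreHom (push i hi (pullbackLeft i m)).toSpanDiagram m.toSpanDiagram where
  f := (pb (ofRight R i) m).fst
  φ := (pb (ofRight R i) m).iso
  σ := 𝟙 _

/-- The transpose of a 2-cell between composites with `(1, U, i)`. -/
noncomputable abbrev transpose (i : U ⟶ D) (hi : R.mem i) {m m' : R.RSpan D W}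
    (k : PreHom (comp (ofRight R i) m).toSpanDiagram (comp (ofRight R i) m').toSpanDiagram) :
    PreHom (push i hi (pullbackLeft i m)).toSpanDiagram m'.toSpanDiagram where
  f := k.f ≫ (pb (ofRight R i) m').fst
  φ := (pb (ofRight R i) m').fill k.f ≪≫
    whiskerRightIso (whiskerLeftIso k.f (ρ_ _).symm ≪≫ k.φ ≪≫ ρ_ _) i
  σ := k.σ ≫ (α_ _ _ _).inv

theorem exists_transpose {i : U ⟶ D} (hi : R.mem i) {m m' : R.RSpan D W}
    (n : PreHom (push i hi (pullbackLeft i m)).toSpanDiagram m'.toSpanDiagram) :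
    ∃ k, cls (transpose i hi k) = cls n := by
  obtain ⟨h, a, b, e⟩ := (pb_isBipullback (ofRight R i) m').exists_lift n.f
    (pullbackLeft i m).left n.φ
  refine ⟨⟨h, whiskerLeftIso h (ρ_ _) ≪≫ b ≪≫ (ρ_ _).symm, n.σ ≫ a.inv ▷ _ ≫ (α_ _ _ _).hom⟩,
    PreHom.cls_eq_iff.2 ⟨a, ?_, ?_⟩⟩
  · simpa using e
  · simp

/-- Span version of `RSlice.pullback_map_cls_eq_iff`: whiskering with `(1, U, i)` corresponds under
transposition to restriction along the counit. -/
theorem hc_cls_eq_iff {i : U ⟶ D} (hi : R.mem i) {m m' : R.RSpan D W}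
    (g : PreHom m.toSpanDiagram m'.toSpanDiagram)
    (k : PreHom (comp (ofRight R i) m).toSpanDiagram (comp (ofRight R i) m').toSpanDiagram) :
    hc (𝟙 (ofRight R i)) (cls g) = cls k ↔ cls (counit i hi m) ≫ cls g = cls (transpose i hi k) := by
  have hl : Lifts (hc (𝟙 (ofRight R i)) (cls g))
      ((unitCone (ofRight R i) m).post (PreHom.id _) g) := lifts_hcomp (PreHom.id _) g
  constructor
  · intro h
    rw [h] at hl
    obtain ⟨ξ, η, hd⟩ := Lifts.rep (k := k) hl
    -- The left factor is an identity 2-cell, so the square being lifted is invertible and hence so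
    -- is `η`. It identifies the two representatives.
    have : IsIso η := Protocalibration.isIso_of_isLift (pb (ofRight R i) m')
      (R.opfib m'.left_mem) (a := ξ)
      (θ := ((unitCone (ofRight R i) m).post (PreHom.id _) g).θ) hd.hθ
    refine PreHom.cls_eq_iff.2 ⟨asIso η, ?_, ?_⟩
    · have h1 := hd.hθ =≫ ((ρ_ _).hom ▷ i)
      simp at h1
      simp [φ_eq_of_isHom hd, h1]
    · simp [σ_eq_of_isHom hd]
  · intro h
    obtain ⟨γ, h1, h2⟩ := PreHom.cls_eq_iff.1 h
    -- Conversely, `γ` makes `k` a lift of the datum that defines the horizontal composite, and such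
    -- lifts are unique.
    refine lift_unique hl (Lifts.le (lifts_coneOf k)
      ⟨whiskerLeftIso k.f (ρ_ _).symm ≪≫ k.φ, γ.hom, ?_, ?_, ?_⟩)
    · have h3 := h1 =≫ ((ρ_ _).inv ▷ i)
      simp at h3
      simp [h3]
    · simp
    · simp at h2
      simp [← h2]

section
variable {i : U ⟶ D} {j : V ⟶ D}

theorem isCoprod_counit (hE : R.IsExtensive) (hR : R.ClosedUnderFiniteBicoproducts)
    (h : IsBinaryBicoproduct i j) (hi : R.mem i) (hj : R.mem j) (m : R.RSpan D W) :
    IsCoprod (cls (counit i hi m)) (cls (counit j hj m)) :=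
  isCoprod_cls _ _ (RSlice.isBinaryBicoproduct_pb hE hR h ⟨m.apex, m.left, m.left_mem⟩)

/-- Equal whiskerings have equal transposes, so `f` and `g` agree on both counits, which are jointly
epic as coprojections of `m`. -/
theorem hc_ofRight_injective (hE : R.IsExtensive) (hR : R.ClosedUnderFiniteBicoproducts)
    (h : IsBinaryBicoproduct i j) {m m' : R.RSpan D W} {f g : m ⟶ m'}
    (h1 : hc (𝟙 (ofRight R i)) f = hc (𝟙 (ofRight R i)) g)
    (h2 : hc (𝟙 (ofRight R j)) f = hc (𝟙 (ofRight R j)) g) : f = g := by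
  obtain ⟨hi, hj⟩ := hR.coprojections h
  obtain ⟨f, rfl⟩ := SpanDiagram.exists_cls f
  obtain ⟨g, rfl⟩ := SpanDiagram.exists_cls g
  obtain ⟨a, ha⟩ := SpanDiagram.exists_cls (hc (𝟙 (ofRight R i)) (cls f))
  obtain ⟨b, hb⟩ := SpanDiagram.exists_cls (hc (𝟙 (ofRight R j)) (cls f))
  refine (isCoprod_counit hE hR h hi hj m).hom_ext
    (((hc_cls_eq_iff hi f a).1 ha.symm).trans ((hc_cls_eq_iff hi g a).1 (h1.symm.trans ha.symm)).symm)
    (((hc_cls_eq_iff hj f b).1 hb.symm).trans ((hc_cls_eq_iff hj g b).1 (h2.symm.trans hb.symm)).symm)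

/-- Transpose `a` and `b`, then copair them out of the coproduct `m`. -/
theorem exists_hc_ofRight (hE : R.IsExtensive) (hR : R.ClosedUnderFiniteBicoproducts)
    (h : IsBinaryBicoproduct i j) {m m' : R.RSpan D W}
    (a : comp (ofRight R i) m ⟶ comp (ofRight R i) m')
    (b : comp (ofRight R j) m ⟶ comp (ofRight R j) m') :
    ∃ f : m ⟶ m', hc (𝟙 (ofRight R i)) f = a ∧ hc (𝟙 (ofRight R j)) f = b := by
  obtain ⟨hi, hj⟩ := hR.coprojections h
  obtain ⟨a, rfl⟩ := SpanDiagram.exists_cls a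
  obtain ⟨b, rfl⟩ := SpanDiagram.exists_cls b
  obtain ⟨f, h1, h2⟩ := (isCoprod_counit hE hR h hi hj m).exists_desc (cls (transpose i hi a))
    (cls (transpose j hj b))
  obtain ⟨f, rfl⟩ := SpanDiagram.exists_cls f
  exact ⟨cls f, (hc_cls_eq_iff hi f a).2 h1, (hc_cls_eq_iff hj f b).2 h2⟩

theorem nonempty_iso_comp_ofRight_left {m : R.RSpan D W} {s : R.RSpan U W}
    (k : RSlice.PreHom (RSlice.pullbackObj i ⟨m.apex, m.left, m.left_mem⟩)
      ⟨s.apex, s.left, s.left_mem⟩) (hk : IsEquiv k.f)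
    (e : (pb (ofRight R i) m).fst ≫ m.right ≅ k.f ≫ s.right) :
    Nonempty (comp (ofRight R i) m ≅ s) := by
  let l : PreHom (comp (ofRight R i) m).toSpanDiagram s.toSpanDiagram :=
    ⟨k.f, k.φ ≪≫ (ρ_ _).symm, e.hom⟩
  have : IsIso (cls l) := isIso_cls l hk
  exact ⟨asIso (cls l)⟩

theorem exists_comp_ofRight_iso (hE : R.IsExtensive) (hR : R.ClosedUnderFiniteBicoproducts)
    (h : IsBinaryBicoproduct i j) (s : R.RSpan U W) (t : R.RSpan V W) :
    ∃ m : R.RSpan D W, Nonempty (comp (ofRight R i) m ≅ s) ∧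
      Nonempty (comp (ofRight R j) m ≅ t) := by
  have := hE.binary h
  let F := (RSlice.pullback R i).prod' (RSlice.pullback R j)
  let o : RSlice R U × RSlice R V := (⟨s.apex, s.left, s.left_mem⟩, ⟨t.apex, t.left, t.left_mem⟩)
  obtain ⟨a, -, ha⟩ := RSlice.isEquiv_of_iso
    ((CategoryTheory.Prod.fst _ _).mapIso (F.objObjPreimageIso o))
  obtain ⟨b, -, hb⟩ := RSlice.isEquiv_of_iso
    ((CategoryTheory.Prod.snd _ _).mapIso (F.objObjPreimageIso o))
  -- Essential surjectivity of `F` has produced the left leg. Its domain is the bicoproduct of its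
  -- two bipullbacks, so the right leg is obtained by copairing those of `s` and `t`.
  obtain ⟨y, ⟨e⟩, ⟨e'⟩⟩ := (RSlice.isBinaryBicoproduct_pb hE hR h (F.objPreimage o)).exists_desc
    (a.f ≫ s.right) (b.f ≫ t.right)
  exact ⟨⟨⟨_, (F.objPreimage o).hom, y⟩, (F.objPreimage o).hom_mem⟩,
    nonempty_iso_comp_ofRight_left a ha e, nonempty_iso_comp_ofRight_left b hb e'⟩

end

theorem isBiinitial_apex_comp (hE : R.IsExtensive) {s : R.RSpan X Y} (h : IsBiinitial s.apex)
    (t : R.RSpan Y Z) : IsBiinitial (comp s t).apex :=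
  RSlice.isBiinitial_dom hE h
    (RSlice.pullbackObj (R := R) s.right ⟨t.apex, t.left, t.left_mem⟩)

/-- The span with bi-initial apex is initial. -/
theorem nonempty_isInitial {s : R.RSpan X Y} (h : IsBiinitial s.apex) :
    Nonempty (IsInitial s) :=
  ⟨@IsInitial.ofUnique _ _ s fun t =>
    (SpanDiagram.nonempty_unique_of_isBiinitial h t.toSpanDiagram).some⟩

end RSpan

/-! ### Bicoproducts of spans and stable local coproducts -/

namespace Spn
variable {C : Type u} [Bicategory.{w, v} C] {R : Protocalibration C}

open RSpan

theorem isBinaryBicoproduct_ofRight (hE : R.IsExtensive) (hR : R.ClosedUnderFiniteBicoproducts)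
    {U V D : C} {i : U ⟶ D} {j : V ⟶ D} (h : IsBinaryBicoproduct i j) :
    IsBinaryBicoproduct (B := Spn R) (U := ⟨U⟩) (V := ⟨V⟩) (D := ⟨D⟩)
      (ofRight R i) (ofRight R j) := fun _ =>
  { faithful := ⟨fun e => hc_ofRight_injective hE hR h (congrArg Prod.fst e)
      (congrArg Prod.snd e)⟩
    full := ⟨fun f => by
      obtain ⟨g, h1, h2⟩ := exists_hc_ofRight hE hR h f.1 f.2
      exact ⟨g, Prod.ext h1 h2⟩⟩
    essSurj := ⟨fun y => by
      obtain ⟨m, ⟨a⟩, ⟨b⟩⟩ := exists_comp_ofRight_iso hE hR h y.1 y.2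
      exact ⟨m, ⟨Iso.prod a b⟩⟩⟩ }

/-- The left leg of a span out of `Z` is an `R`-object over a bi-initial object, so its apex is
bi-initial and there is exactly one 2-cell to any parallel span. -/
theorem isBiinitial_mk (hE : R.IsExtensive) {Z : C} (hZ : IsBiinitial Z) :
    IsBiinitial (B := Spn R) ⟨Z⟩ := fun W => by
  rw [isEquivalence_star_iff]
  obtain ⟨f⟩ := hZ.nonempty W.base
  exact ⟨⟨ofRight R f⟩, fun s t => SpanDiagram.nonempty_unique_of_isBiinitial
    (RSlice.isBiinitial_dom hE hZ ⟨_, _, s.left_mem⟩) t.toSpanDiagram⟩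

theorem hasFiniteBicoproducts (hE : R.IsExtensive) (hR : R.ClosedUnderFiniteBicoproducts) :
    HasFiniteBicoproducts (Spn R) where
  exists_biinitial := by
    obtain ⟨Z, hZ⟩ := hE.hasFiniteBicoproducts.exists_biinitial
    exact ⟨⟨Z⟩, isBiinitial_mk hE hZ⟩
  exists_binary U V := by
    obtain ⟨D, i, j, h⟩ := hE.hasFiniteBicoproducts.exists_binary U.base V.base
    exact ⟨⟨D⟩, ofRight R i, ofRight R j, isBinaryBicoproduct_ofRight hE hR h⟩

/-- The coproduct and its stability are asserted together for the same coprojections, since both are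
instances of `key`. -/
theorem exists_isCoprod (hE : R.IsExtensive) (hR : R.ClosedUnderFiniteBicoproducts)
    {X Y : Spn R} (s s' : X ⟶ Y) : ∃ (q : X ⟶ Y) (f : s ⟶ q) (g : s' ⟶ q), IsCoprod f g ∧
      ∀ (Z : Spn R) (t : Y ⟶ Z), IsCoprod (f ▷ t) (g ▷ t) := by
  obtain ⟨D, a, b, h⟩ := hE.hasFiniteBicoproducts.exists_binary s.apex s'.apex
  obtain ⟨x, ⟨e1⟩, ⟨e2⟩⟩ := h.exists_desc s.left s'.left
  obtain ⟨y, ⟨e3⟩, ⟨e4⟩⟩ := h.exists_desc s.right s'.right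
  have ha : R.mem (a ≫ x) := R.mem_of_iso e1.symm s.left_mem
  have hb : R.mem (b ≫ x) := R.mem_of_iso e2.symm s'.left_mem
  have hx : R.mem x := hR.copairing x h ha hb
  obtain ⟨c⟩ := nonempty_iso_comp_ofRight s ha e1 e3
  obtain ⟨d⟩ := nonempty_iso_comp_ofRight s' hb e2 e4
  let D' : Spn R := ⟨D⟩
  let p : X ⟶ D' := ⟨⟨s.apex, a ≫ x, a⟩, ha⟩
  let p' : X ⟶ D' := ⟨⟨s'.apex, b ≫ x, b⟩, hb⟩
  let r : X ⟶ D' := ofLeft x hx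
  let f : p ⟶ r := cls (inclusion a x)
  let g : p' ⟶ r := cls (inclusion b x)
  let y' : D' ⟶ Y := ofRight R y
  have key : ∀ {Z : Spn R} (m : D' ⟶ Z), IsCoprod (f ▷ m) (g ▷ m) :=
    fun m => isCoprod_inclusion hE hR h x hx ha hb m
  let c' : s ≅ p ≫ y' := c
  let d' : s' ≅ p' ≫ y' := d
  refine ⟨r ≫ y', c'.hom ≫ f ▷ y', d'.hom ≫ g ▷ y', ?_, fun Z t => ?_⟩
  · simpa using (key y').iso_comp c' d' (Iso.refl _)
  -- Reassociating moves `t` into the second factor, where `key` allows any span out of `D`.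
  · simpa using (key (y' ≫ t)).iso_comp (whiskerRightIso c' t ≪≫ α_ _ _ _)
      (whiskerRightIso d' t ≪≫ α_ _ _ _) (α_ _ _ _).symm

end Spn

end RSpn

/-! ### From initial objects and binary coproducts to finite coproducts -/

theorem proposition6 {C : Type u} [Bicategory.{w, v} C] (R : RSpn.Protocalibration C)
    (hE : R.IsExtensive) (hR : R.ClosedUnderFiniteBicoproducts) :
    RSpn.HasFiniteBicoproducts (RSpn.Spn R) ∧
      ∀ X Y : RSpn.Spn R, HasFiniteCoproducts (X ⟶ Y) ∧
        ∀ (Z : RSpn.Spn R) (t : Y ⟶ Z), PreservesFiniteCoproducts (postcomp X t) := by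
  refine ⟨RSpn.Spn.hasFiniteBicoproducts hE hR, fun X Y => ?_⟩
  obtain ⟨I, hI⟩ := hE.hasFiniteBicoproducts.exists_biinitial
  obtain ⟨x⟩ := hI.nonempty X.base
  obtain ⟨y⟩ := hI.nonempty Y.base
  let z : X ⟶ Y := (⟨⟨I, x, y⟩, hR.from_biinitial x hI⟩ : R.RSpan X.base Y.base)
  have hz : IsInitial z := (RSpn.RSpan.nonempty_isInitial (R := R) hI).some
  have hasI : HasInitial (X ⟶ Y) := hz.hasInitial
  have hasB : HasBinaryCoproducts (X ⟶ Y) :=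
    @hasBinaryCoproducts_of_hasColimit_pair _ _ fun {s s'} => by
      obtain ⟨q, f, g, h, -⟩ := RSpn.Spn.exists_isCoprod hE hR s s'
      exact h.hasBinaryCoproduct
  have hasC : HasFiniteCoproducts (X ⟶ Y) := hasFiniteCoproducts_of_has_binary_and_initial
  refine ⟨hasC, fun Z t => ?_⟩
  have hB : PreservesColimitsOfShape (Discrete WalkingPair) (postcomp X t) :=
    ⟨fun {K} => by
      obtain ⟨q, f, g, h, h'⟩ := RSpn.Spn.exists_isCoprod hE hR (K.obj ⟨.left⟩) (K.obj ⟨.right⟩)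
      have := h.preservesColimit (postcomp X t) (h' Z t)
      exact preservesColimit_of_iso_diagram _ (diagramIsoPair K).symm⟩
  -- The apex of `z` followed by `t` lies over `I` by a 1-cell in `R`, hence is again bi-initial.
  have hz' : IsInitial ((postcomp X t).obj z) :=
    (RSpn.RSpan.nonempty_isInitial (RSpn.RSpan.isBiinitial_apex_comp hE
      (s := (⟨⟨I, x, y⟩, hR.from_biinitial x hI⟩ : R.RSpan X.base Y.base)) hI t)).some
  have hI' : PreservesColimitsOfShape (Discrete PEmpty.{1}) (postcomp X t) := by
    have : PreservesColimit (Functor.empty.{0} (X ⟶ Y)) (postcomp X t) :=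
      preservesColimit_of_preserves_colimit_cocone hz
        ((isColimitMapCoconeEmptyCoconeEquiv (postcomp X t) z).symm hz')
    exact preservesColimitsOfShape_pempty_of_preservesInitial _
  exact ⟨fun n => PreservesFiniteCoproducts.of_preserves_binary_and_initial _ _⟩
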